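/- Conventions. $\overline{\mathbb R}_+=[0,\infty]$ and $\mathbb R_+=[0,\infty)$ carry the Scott topology (nontrivial open sets: the intervals unbounded above $\{t : t>r\}$). A \emph{cone} is a commutative monoid with a scalar multiplication by $\mathbb R_+$ satisfying the usual module axioms (so $0\cdot x=0$, $r\cdot 0=0$). A \emph{topological cone} is a cone with a $T_0$ topology making addition $C\times C\to C$ and scalar multiplication $\mathbb R_+\times C\to C$ jointly continuous. It is \emph{weakly locally convex} if every open neighbourhood of every point $x$ contains a convex (not necessarily open) neighbourhood of $x$. A map between cones is \emph{linear} if it preserves addition and multiplication by scalars in $\mathbb R_+$. For a topological space $X$ with lattice $\mathcal OX$ of open sets, a \emph{point-continuous valuation} on $X$ is a map $\mu:\mathcal OX\to\overline{\mathbb R}_+$ with $\mu(\emptyset)=0$, $\mu(U)\le\mu(V)$ for $U\subseteq V$, $\mu(U)+\mu(V)=\mu(U\cup V)+\mu(U\cap V)$, that is continuous when $\mathcal OX$ has the topology generated by the sets $\{U\mid x\in U\}$, $x\in X$. $\mathcal V_{\mathrm p}X$ is the space of all of them, with the topology generated by the sets $\{\mu\mid\mu(U)>r\}$ ($U\in\mathcal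 OX$, $r\in\mathbb R_+$) and the pointwise addition and scalar multiplication. The Dirac mass is $\delta_x(U)=1$ if $x\in U$ and $0$ otherwise. For $h:X\to\overline{\mathbb R}_+$ lower semicontinuous, $\int h\,d\mu=\int_0^\infty\mu(h^{-1}(t,\infty])\,dt$. For $f:X\to Y$ continuous, $\mathcal V_{\mathrm p}f(\mu)(V)=\mu(f^{-1}(V))$. $\mathcal V_{\mathrm p}$ is a monad on the category of $T_0$ spaces and continuous maps, with unit $x\mapsto\delta_x$ and multiplication $m_X(\varpi)(U)=\int_{\mu\in\mathcal V_{\mathrm p}X}\mu(U)\,d\varpi$; a \emph{$\mathcal V_{\mathrm p}$-algebra} is a pair $(X,\alpha)$ with $\alpha:\mathcal V_{\mathrm p}X\to X$ continuous, $\alpha(\delta_x)=x$ for all $x\in X$, and $\alpha\circ m_X=\alpha\circ\mathcal V_{\mathrm p}\alpha$. If $X$ is a topological cone, a \emph{(Choquet) barycentre} of $\mu\in\mathcal V_{\mathrm p}X$ is a point $b\in X$ with $\Lambda(b)=\int\Lambda\,d\mu$ for every lower semicontinuous linear map $\Lambda:X\to\overline{\mathbb R}_+$. Theorem. (1) Let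 $X$ be a $T_0$ topological space and $\alpha:\mathcal V_{\mathrm p}X\to X$ a function such that $(X,\alpha)$ is a $\mathcal V_{\mathrm p}$-algebra. Then, with the operations $x+y=\alpha(\delta_x+\delta_y)$ and $r\cdot x=\alpha(r\delta_x)$, $X$ is a weakly locally convex sober topological cone, and $\alpha$ is a continuous linear map that sends every $\mu\in\mathcal V_{\mathrm p}X$ to one of its barycentres, and $\alpha(\delta_x)=x$ for every $x\in X$. (2) Conversely, for every weakly locally convex sober topological cone $C$ there is a unique continuous linear map $\alpha:\mathcal V_{\mathrm p}C\to C$ with $\alpha(\delta_x)=x$ for every $x\in C$, and for this $\alpha$ the pair $(C,\alpha)$ is a $\mathcal V_{\mathrm p}$-algebra. -/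

import Mathlib

open TopologicalSpace MeasureTheory Set
open scoped NNReal ENNReal

noncomputable section

/-! ### Point-continuous valuations -/

/-- The point topology on the lattice of open subsets of `X`, generated by the sets
`{U | x ∈ U}`, for `x : X`. -/
@[reducible]
def pointTopology (X : Type*) [TopologicalSpace X] : TopologicalSpace (Opens X) :=
  generateFrom {S : Set (Opens X) | ∃ x : X, S = {U | x ∈ U}}

/-- A point-continuous valuation on `X`: a strict, monotone, modular map from the open subsets
of `X` to `[0, ∞]` that is continuous from the point topology to the Scott topology of `[0, ∞]`.
Continuity of a map into `[0, ∞]` with its Scott topology (whose nontrivial open sets are the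
intervals `(r, ∞]`) is lower semicontinuity. -/
@[ext]
structure PointValuation (X : Type*) [TopologicalSpace X] where
  /-- The value of the valuation on an open set. -/
  toFun : Opens X → ℝ≥0∞
  strict : toFun ⊥ = 0
  mono : Monotone toFun
  modular : ∀ U V : Opens X, toFun U + toFun V = toFun (U ⊔ V) + toFun (U ⊓ V)
  pointContinuous : @LowerSemicontinuous (Opens X) ℝ≥0∞ (pointTopology X) _ toFun

namespace PointValuation

variable {X Y : Type*} [TopologicalSpace X] [TopologicalSpace Y]

instance : CoeFun (PointValuation X) fun _ => Opens X → ℝ≥0∞ := ⟨toFun⟩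

/-- The weak topology, generated by the sets `[U > r] = {μ | μ U > r}`, for `U` open in `X` and
`r` a nonnegative real number. -/
instance : TopologicalSpace (PointValuation X) :=
  generateFrom {S | ∃ (U : Opens X) (r : ℝ≥0), S = {μ : PointValuation X | (r : ℝ≥0∞) < μ U}}

theorem lowerSemicontinuous_of_finite {f : Opens X → ℝ≥0∞}
    (h : ∀ (U : Opens X) (r : ℝ≥0∞), r < f U →
      ∃ F : Set X, F.Finite ∧ F ⊆ U ∧ ∀ V : Opens X, F ⊆ V → r < f V) :
    @LowerSemicontinuous (Opens X) ℝ≥0∞ (pointTopology X) _ f := by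
  let := pointTopology X
  intro U r hr
  obtain ⟨F, hF, hFU, hV⟩ := h U r hr
  have ho : IsOpen (⋂ x ∈ F, {V : Opens X | x ∈ V}) :=
    hF.isOpen_biInter fun x _ => isOpen_generateFrom_of_mem ⟨x, rfl⟩
  refine Filter.mem_of_superset (ho.mem_nhds ?_) ?_
  · simp only [mem_iInter, mem_ofPred_eq]
    exact fun x hx => hFU hx
  · intro V hVm
    simp only [mem_iInter, mem_ofPred_eq] at hVm
    exact hV V hVm

theorem exists_finite (μ : PointValuation X) {U : Opens X} {r : ℝ≥0∞} (hr : r < μ U) :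
    ∃ F : Set X, F.Finite ∧ F ⊆ U ∧ ∀ V : Opens X, F ⊆ V → r < μ V := by
  let := pointTopology X
  have ho : IsOpen (μ.toFun ⁻¹' Ioi r) := μ.pointContinuous.isOpen_preimage r
  obtain ⟨_, ⟨T, ⟨hT, hTs⟩, rfl⟩, hUT, hsub⟩ :=
    (isTopologicalBasis_of_subbasis (s := {S : Set (Opens X) | ∃ x : X, S = {U | x ∈ U}})
      rfl).exists_subset_of_mem_open (show U ∈ μ.toFun ⁻¹' Ioi r from hr) ho
  have hex : ∀ S ∈ T, ∃ F : Set X, F.Finite ∧ S = {V : Opens X | F ⊆ V} := fun S hS => by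
    obtain ⟨x, rfl⟩ := hTs hS
    exact ⟨{x}, finite_singleton x, by ext V; simp⟩
  choose! p hpf hp using hex
  refine ⟨⋃ S ∈ T, p S, hT.biUnion hpf, iUnion₂_subset fun S hS => ?_, fun V hV => hsub ?_⟩
  · have h1 := hUT S hS
    rw [hp S hS] at h1
    exact h1
  · intro S hS
    rw [hp S hS]
    exact (subset_biUnion_of_mem (u := p) hS).trans hV

/-! ### The cone of point-continuous valuations -/

instance : Zero (PointValuation X) :=
  ⟨{ toFun := fun _ => 0
     strict := rfl
     mono := fun _ _ _ => le_rfl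
     modular := fun _ _ => rfl
     pointContinuous := by
      let := pointTopology X
      exact lowerSemicontinuous_const }⟩

instance : Add (PointValuation X) :=
  ⟨fun μ ν =>
   { toFun := fun U => μ U + ν U
     strict := by simp [μ.strict, ν.strict]
     mono := fun _ _ h => add_le_add (μ.mono h) (ν.mono h)
     modular := fun U V => by
      rw [add_add_add_comm, μ.modular, ν.modular, add_add_add_comm]
     pointContinuous := by
      let := pointTopology X
      exact μ.pointContinuous.add ν.pointContinuous }⟩

instance : SMul ℝ≥0 (PointValuation X) :=
  ⟨fun r μ =>
   { toFun := fun U => (r : ℝ≥0∞) * μ U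
     strict := by simp [μ.strict]
     mono := fun _ _ h => mul_le_mul_right (μ.mono h) _
     modular := fun U V => by
      rw [← mul_add, μ.modular, mul_add]
     pointContinuous := by
      let := pointTopology X
      exact (ENNReal.continuous_const_mul ENNReal.coe_ne_top).comp_lowerSemicontinuous
        μ.pointContinuous fun _ _ h => mul_le_mul_right h _ }⟩

theorem zero_apply (U : Opens X) : (0 : PointValuation X) U = 0 := rfl

theorem add_apply (μ ν : PointValuation X) (U : Opens X) : (μ + ν) U = μ U + ν U := rfl

theorem smul_apply (r : ℝ≥0) (μ : PointValuation X) (U : Opens X) :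
    (r • μ) U = (r : ℝ≥0∞) * μ U := rfl

instance : AddCommMonoid (PointValuation X) where
  add_assoc μ ν κ := by ext U; exact add_assoc _ _ _
  zero_add μ := by ext U; exact zero_add _
  add_zero μ := by ext U; exact add_zero _
  add_comm μ ν := by ext U; exact add_comm _ _
  nsmul := nsmulRec

instance : Module ℝ≥0 (PointValuation X) where
  one_smul μ := by ext U; simp [smul_apply]
  mul_smul r s μ := by ext U; simp [smul_apply, mul_assoc]
  smul_zero r := by ext U; simp [smul_apply, zero_apply]
  smul_add r μ ν := by ext U; simp [smul_apply, add_apply, mul_add]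
  add_smul r s μ := by ext U; simp [smul_apply, add_apply, add_mul]
  zero_smul μ := by ext U; simp [smul_apply, zero_apply]

/-! ### Dirac masses, images, integrals -/

open Classical in
/-- The Dirac mass at `x`. -/
def dirac (x : X) : PointValuation X where
  toFun U := if x ∈ U then 1 else 0
  strict := by simp
  mono U V h := by
    by_cases hx : x ∈ U
    · simp [hx, h hx]
    · simp [hx]
  modular U V := by
    by_cases hU : x ∈ U <;> by_cases hV : x ∈ V <;> simp [hU, hV]
  pointContinuous := by
    refine lowerSemicontinuous_of_finite fun U r hr => ?_
    by_cases hx : x ∈ U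
    · refine ⟨{x}, finite_singleton x, by simpa using hx, fun V hV => ?_⟩
      have : x ∈ V := hV rfl
      simpa [hx, this] using hr
    · simp [hx] at hr

/-- The image of a point-continuous valuation under a continuous map (the action on morphisms of
the functor of point-continuous valuations). -/
def map (f : X → Y) (hf : Continuous f) (μ : PointValuation X) : PointValuation Y where
  toFun V := μ (Opens.comap ⟨f, hf⟩ V)
  strict := μ.strict
  mono _ _ h := μ.mono fun _ hx => h hx
  modular U V := μ.modular (Opens.comap ⟨f, hf⟩ U) (Opens.comap ⟨f, hf⟩ V)
  pointContinuous := by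
    refine lowerSemicontinuous_of_finite fun U r hr => ?_
    obtain ⟨F, hF, hFU, hV⟩ := μ.exists_finite hr
    refine ⟨f '' F, hF.image f, ?_, fun V hFV => hV _ ?_⟩
    · rintro _ ⟨x, hx, rfl⟩
      exact hFU hx
    · exact fun x hx => hFV ⟨x, hx, rfl⟩

/-- The open set `h⁻¹(t, ∞]`, for `h` lower semicontinuous. -/
def superlevel (h : X → ℝ≥0∞) (hh : LowerSemicontinuous h) (t : ℝ≥0∞) : Opens X :=
  ⟨{x | t < h x}, hh.isOpen_preimage t⟩

/-- The integral `∫ h dμ = ∫₀^∞ μ (h⁻¹(t, ∞]) dt` of a lower semicontinuous map `h : X → [0, ∞]`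
with respect to `μ`. The integrand is antitone in `t`, so that the Lebesgue integral on the right
is the (improper) Riemann integral. -/
def integral (μ : PointValuation X) (h : X → ℝ≥0∞) (hh : LowerSemicontinuous h) : ℝ≥0∞ :=
  ∫⁻ t in Ioi (0 : ℝ), μ (superlevel h hh (ENNReal.ofReal t))

/-! ### Facts on the integral needed for the extension operation -/

theorem mem_superlevel {h : X → ℝ≥0∞} {hh : LowerSemicontinuous h} {t : ℝ≥0∞} {x : X} :
    x ∈ superlevel h hh t ↔ t < h x := Iff.rfl

theorem antitone_superlevel (h : X → ℝ≥0∞) (hh : LowerSemicontinuous h) :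
    Antitone fun t : ℝ => superlevel h hh (ENNReal.ofReal t) := fun _ _ hst _ hx =>
  lt_of_le_of_lt (ENNReal.ofReal_le_ofReal hst) hx

theorem integral_congr (μ : PointValuation X) {h k : X → ℝ≥0∞} (e : h = k)
    (hh : LowerSemicontinuous h) (hk : LowerSemicontinuous k) :
    μ.integral h hh = μ.integral k hk := by
  subst e; rfl

theorem integral_mono (μ : PointValuation X) {h k : X → ℝ≥0∞} (e : h ≤ k)
    (hh : LowerSemicontinuous h) (hk : LowerSemicontinuous k) :
    μ.integral h hh ≤ μ.integral k hk :=
  lintegral_mono fun _ => μ.mono fun x hx => lt_of_lt_of_le hx (e x)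

theorem integral_zero (μ : PointValuation X) :
    μ.integral (fun _ => 0) lowerSemicontinuous_const = 0 := by
  have : ∀ t, superlevel (fun _ : X => (0 : ℝ≥0∞)) lowerSemicontinuous_const t = ⊥ := by
    intro t; ext x; simp [superlevel]
  simp [integral, this, μ.strict]

/-- Continuity of valuations along increasing sequences of open sets. -/
theorem iSup_apply (μ : PointValuation X) {U : ℕ → Opens X} (hU : Monotone U) {V : Opens X}
    (hV : ∀ x, x ∈ V ↔ ∃ n, x ∈ U n) : μ V = ⨆ n, μ (U n) := by
  apply le_antisymm
  · refine le_of_forall_lt fun r hr => ?_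
    obtain ⟨F, hF, hFV, hW⟩ := μ.exists_finite hr
    have : ∃ n, F ⊆ U n := by
      choose! n hn using fun x (hx : x ∈ F) => (hV x).1 (hFV hx)
      obtain ⟨m, hm⟩ := (hF.image n).bddAbove
      exact ⟨m, fun x hx => hU (hm ⟨x, hx, rfl⟩) (hn x hx)⟩
    obtain ⟨n, hn⟩ := this
    exact lt_of_lt_of_le (hW _ hn) (le_iSup (fun n => μ (U n)) n)
  · exact iSup_le fun n => μ.mono fun x hx => (hV x).2 ⟨n, hx⟩

theorem integral_iSup (μ : PointValuation X) {h : ℕ → X → ℝ≥0∞} (hm : Monotone h)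
    (hh : ∀ n, LowerSemicontinuous (h n)) {k : X → ℝ≥0∞} (hk : LowerSemicontinuous k)
    (e : ∀ x, k x = ⨆ n, h n x) : μ.integral k hk = ⨆ n, μ.integral (h n) (hh n) := by
  unfold integral
  rw [← lintegral_iSup]
  · refine lintegral_congr fun t => ?_
    refine μ.iSup_apply (U := fun n => superlevel (h n) (hh n) (ENNReal.ofReal t)) ?_ ?_
    · exact fun m n hmn x hx => lt_of_lt_of_le hx (hm hmn x)
    · intro x
      simp only [mem_superlevel, e, lt_iSup_iff]
  · intro n
    exact (μ.mono.comp_antitone (antitone_superlevel (h n) (hh n))).measurable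
  · exact fun m n hmn t => μ.mono fun x hx => lt_of_lt_of_le hx (hm hmn x)

theorem lowerSemicontinuous_step (ε : ℝ≥0) (U : Opens X) :
    LowerSemicontinuous ((U : Set X).indicator fun _ => (ε : ℝ≥0∞)) :=
  U.isOpen.lowerSemicontinuous_indicator zero_le

theorem integral_add_step (μ : PointValuation X) (f : X → ℝ≥0∞) (hf : LowerSemicontinuous f)
    (ε : ℝ≥0) (U : Opens X) :
    μ.integral (fun x => f x + (U : Set X).indicator (fun _ => (ε : ℝ≥0∞)) x)
      (hf.add (lowerSemicontinuous_step ε U)) = μ.integral f hf + ε * μ U := by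
  classical
  let L : ℝ → Opens X := fun t => if t < 0 then ⊤ else superlevel f hf (ENNReal.ofReal t)
  have hL : Antitone L := by
    intro s t hst
    by_cases hs : s < 0
    · simp [L, hs]
    · have ht : ¬ t < 0 := by linarith
      simp only [L, hs, ht, if_false]
      exact antitone_superlevel f hf hst
  let G : ℝ → ℝ≥0∞ := fun t => μ (L t ⊓ U)
  have hGa : Antitone G := fun s t hst => μ.mono (inf_le_inf_right U (hL hst))
  have hG : Measurable G := hGa.measurable
  have hLm : Measurable fun t => μ (superlevel f hf (ENNReal.ofReal t)) :=
    (μ.mono.comp_antitone (antitone_superlevel f hf)).measurable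
  -- the integral of `t ↦ G (t - ε)`
  have hshift : ∫⁻ t in Ioi (0 : ℝ), G (t - ε) = ε * μ U + ∫⁻ t in Ioi (0 : ℝ), G t := by
    rw [← setLIntegral_congr (Ioi_ae_eq_Ici (μ := volume) (a := (0 : ℝ))).symm]
    have h1 := (measurePreserving_sub_right volume (ε : ℝ)).setLIntegral_comp_preimage
      (measurableSet_Ici (a := -(ε : ℝ))) hG
    have h2 : (fun t : ℝ => t - ε) ⁻¹' Ici (-(ε : ℝ)) = Ici 0 := by
      ext t; simp
    rw [h2] at h1
    rw [setLIntegral_congr (Ioi_ae_eq_Ici (μ := volume) (a := (0 : ℝ))), h1,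
      ← Ico_union_Ici_eq_Ici (show -(ε : ℝ) ≤ 0 by simp),
      lintegral_union measurableSet_Ici]
    · congr 1
      rw [setLIntegral_congr_fun (g := fun _ => μ U) measurableSet_Ico]
      · simp [mul_comm]
      · intro t ht
        simp [G, L, ht.2]
    · rw [Set.disjoint_left]
      exact fun t ht ht' => absurd ht.2 (not_lt.2 ht')
  -- modularity applied to the superlevel sets of the sum
  have hkey : ∀ t ∈ Ioi (0 : ℝ),
      μ (superlevel _ (hf.add (lowerSemicontinuous_step ε U)) (ENNReal.ofReal t)) + G t
        = μ (superlevel f hf (ENNReal.ofReal t)) + G (t - ε) := by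
    intro t ht
    have ht0 : ¬ t < 0 := not_lt.2 (le_of_lt ht)
    have hLt : L t = superlevel f hf (ENNReal.ofReal t) := by simp [L, ht0]
    have hsub : L t ≤ L (t - ε) := hL (by simp)
    have hsup : superlevel _ (hf.add (lowerSemicontinuous_step ε U)) (ENNReal.ofReal t)
        = L t ⊔ (L (t - ε) ⊓ U) := by
      rw [hLt]
      ext x
      simp only [Opens.coe_sup, Opens.coe_inf, mem_union, mem_inter_iff, SetLike.mem_coe,
        mem_superlevel]
      by_cases hx : x ∈ U
      · simp only [SetLike.mem_coe, hx, indicator_of_mem, and_true]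
        by_cases hte : t - ε < 0
        · simp only [L, hte, if_true]
          refine iff_of_true ?_ (Or.inr trivial)
          refine lt_of_lt_of_le ?_ le_add_self
          rw [← ENNReal.ofReal_coe_nnreal]
          exact (ENNReal.ofReal_lt_ofReal_iff_of_nonneg (le_of_lt ht)).2 (by linarith)
        · simp only [L, hte, if_false, mem_superlevel]
          have hsubr : ENNReal.ofReal (t - ε) = ENNReal.ofReal t - ENNReal.ofReal ε :=
            ENNReal.ofReal_sub t ε.2
          rw [hsubr, ENNReal.ofReal_coe_nnreal]
          constructor
          · intro h
            refine Or.inr ?_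
            rw [add_comm] at h
            refine (ENNReal.sub_lt_iff_lt_left ENNReal.coe_ne_top ?_).2 h
            rw [← ENNReal.ofReal_coe_nnreal]
            exact ENNReal.ofReal_le_ofReal (by linarith)
          · rintro (h | h)
            · exact lt_of_lt_of_le h le_self_add
            · rw [add_comm]
              by_contra hle
              exact absurd h (not_lt.2
                (ENNReal.le_sub_of_add_le_left ENNReal.coe_ne_top (not_lt.1 hle)))
      · simp [hx]
    have hmod := μ.modular (L t) (L (t - ε) ⊓ U)
    rw [← inf_assoc, inf_eq_left.2 hsub, ← hsup, hLt] at hmod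
    simp only [G]
    rw [hLt]
    exact hmod.symm
  have hsum : μ.integral _ (hf.add (lowerSemicontinuous_step ε U))
      + ∫⁻ t in Ioi (0 : ℝ), G t = (μ.integral f hf + ε * μ U) + ∫⁻ t in Ioi (0 : ℝ), G t := by
    rw [add_assoc, ← hshift]
    unfold integral
    rw [← lintegral_add_right _ hG, ← lintegral_add_left hLm]
    exact setLIntegral_congr_fun measurableSet_Ioi hkey
  by_cases hfin : ∫⁻ t in Ioi (0 : ℝ), G t = ∞
  · have hle : ∫⁻ t in Ioi (0 : ℝ), G t ≤ μ.integral f hf := by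
      refine setLIntegral_mono' measurableSet_Ioi fun t ht => μ.mono ?_
      have ht0 : ¬ t < 0 := not_lt.2 (le_of_lt ht)
      simp [L, ht0]
    have h1 : μ.integral f hf = ∞ := by
      rw [hfin] at hle; exact top_le_iff.1 hle
    have h2 : μ.integral f hf
        ≤ μ.integral _ (hf.add (lowerSemicontinuous_step ε U)) :=
      μ.integral_mono (fun x => le_self_add) _ _
    rw [h1] at h2 ⊢
    rw [top_le_iff.1 h2, top_add]
  · exact (ENNReal.add_left_inj hfin).1 hsum

/-- The dyadic step functions that approximate `h` from below. -/
def step (h : X → ℝ≥0∞) (hh : LowerSemicontinuous h) (N M : ℕ) (x : X) : ℝ≥0∞ :=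
  ∑ j ∈ Finset.range M,
    (superlevel h hh (((j + 1 : ℕ) * (2 ^ N)⁻¹ : ℝ≥0) : ℝ≥0∞) : Set X).indicator
      (fun _ => (((2 ^ N)⁻¹ : ℝ≥0) : ℝ≥0∞)) x

theorem lowerSemicontinuous_step_sum (h : X → ℝ≥0∞) (hh : LowerSemicontinuous h) (N M : ℕ) :
    LowerSemicontinuous (step h hh N M) :=
  lowerSemicontinuous_sum fun _ _ => lowerSemicontinuous_step _ _

theorem integral_add_step_sum (μ : PointValuation X) (f : X → ℝ≥0∞)
    (hf : LowerSemicontinuous f) (h : X → ℝ≥0∞) (hh : LowerSemicontinuous h) (N M : ℕ) :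
    μ.integral (fun x => f x + step h hh N M x)
      (hf.add (lowerSemicontinuous_step_sum h hh N M)) =
    μ.integral f hf + ∑ j ∈ Finset.range M, (((2 ^ N)⁻¹ : ℝ≥0) : ℝ≥0∞) *
      μ (superlevel h hh (((j + 1 : ℕ) * (2 ^ N)⁻¹ : ℝ≥0) : ℝ≥0∞)) := by
  induction M with
  | zero =>
    simp only [Finset.range_zero, Finset.sum_empty, add_zero]
    exact μ.integral_congr (by ext x; simp [step]) _ _
  | succ M ih =>
    rw [Finset.sum_range_succ, ← add_assoc, ← ih, ← integral_add_step]
    refine μ.integral_congr ?_ _ _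
    ext x
    rw [step, Finset.sum_range_succ, ← add_assoc]
    rfl

theorem integral_step_sum (μ : PointValuation X) (h : X → ℝ≥0∞) (hh : LowerSemicontinuous h)
    (N M : ℕ) :
    μ.integral (step h hh N M) (lowerSemicontinuous_step_sum h hh N M) =
    ∑ j ∈ Finset.range M, (((2 ^ N)⁻¹ : ℝ≥0) : ℝ≥0∞) *
      μ (superlevel h hh (((j + 1 : ℕ) * (2 ^ N)⁻¹ : ℝ≥0) : ℝ≥0∞)) := by
  have h1 := μ.integral_add_step_sum (fun _ => 0) lowerSemicontinuous_const h hh N M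
  rw [integral_zero, zero_add] at h1
  rw [← h1]
  exact μ.integral_congr (by ext x; simp) _ _

theorem monotone_step (h : X → ℝ≥0∞) (hh : LowerSemicontinuous h) :
    Monotone fun N => step h hh N (N * 2 ^ N) := by
  refine monotone_nat_of_le_succ fun N x => ?_
  have hdouble : ∀ (a : ℕ → ℝ≥0∞) (M : ℕ), ∑ j ∈ Finset.range (2 * M), a j
      = ∑ j ∈ Finset.range M, (a (2 * j) + a (2 * j + 1)) := by
    intro a M
    induction M with
    | zero => simp
    | succ M ih =>
      rw [Finset.sum_range_succ, ← ih, show 2 * (M + 1) = 2 * M + 1 + 1 by ring,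
        Finset.sum_range_succ, Finset.sum_range_succ, add_assoc]
  have hle : 2 * (N * 2 ^ N) ≤ (N + 1) * 2 ^ (N + 1) := by
    rw [pow_succ]; nlinarith [Nat.zero_le (2 ^ N)]
  refine le_trans ?_ (Finset.sum_le_sum_of_subset (Finset.range_mono hle))
  rw [hdouble]
  refine Finset.sum_le_sum fun j _ => ?_
  by_cases hx : x ∈ superlevel h hh (((j + 1 : ℕ) * (2 ^ N)⁻¹ : ℝ≥0) : ℝ≥0∞)
  · have e2 : ((2 * j + 1 + 1 : ℕ) * (2 ^ (N + 1))⁻¹ : ℝ≥0) = (j + 1 : ℕ) * (2 ^ N)⁻¹ := by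
      rw [pow_succ]; push_cast; field_simp; ring
    have e1 : ((2 * j + 1 : ℕ) * (2 ^ (N + 1))⁻¹ : ℝ≥0) ≤ (j + 1 : ℕ) * (2 ^ N)⁻¹ := by
      rw [← e2]; gcongr; simp
    have m2 : x ∈ superlevel h hh (((2 * j + 1 + 1 : ℕ) * (2 ^ (N + 1))⁻¹ : ℝ≥0) : ℝ≥0∞) := by
      rw [e2]; exact hx
    have m1 : x ∈ superlevel h hh (((2 * j + 1 : ℕ) * (2 ^ (N + 1))⁻¹ : ℝ≥0) : ℝ≥0∞) :=
      lt_of_le_of_lt (ENNReal.coe_le_coe.2 e1) hx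
    rw [indicator_of_mem (SetLike.mem_coe.2 hx), indicator_of_mem (SetLike.mem_coe.2 m1),
      indicator_of_mem (SetLike.mem_coe.2 m2), ← ENNReal.coe_add, ENNReal.coe_le_coe, pow_succ]
    apply le_of_eq
    field_simp
    norm_num
  · rw [indicator_of_notMem (by simpa using hx)]
    exact zero_le

theorem iSup_step (h : X → ℝ≥0∞) (hh : LowerSemicontinuous h) (x : X) :
    h x = ⨆ N, step h hh N (N * 2 ^ N) x := by
  apply le_antisymm
  · refine le_of_forall_lt fun c hc => ?_
    lift c to ℝ≥0 using hc.ne_top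
    obtain ⟨d, hcd, hd⟩ := ENNReal.lt_iff_exists_nnreal_btwn.1 hc
    have hcd' : c < d := ENNReal.coe_lt_coe.1 hcd
    obtain ⟨n, hn⟩ := exists_pow_lt_of_lt_one (tsub_pos_of_lt hcd')
      (show (2⁻¹ : ℝ≥0) < 1 by
        rw [inv_lt_one₀ (by norm_num)]; norm_num)
    obtain ⟨m, hm⟩ := exists_nat_ge (c + 1)
    let N := max n m
    have hN1 : c + (2 ^ N)⁻¹ < d := by
      have : ((2 : ℝ≥0) ^ N)⁻¹ ≤ 2⁻¹ ^ n := by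
        rw [inv_pow]
        gcongr
        · norm_num
        · exact le_max_left n m
      have h2 : ((2 : ℝ≥0) ^ N)⁻¹ < d - c := lt_of_le_of_lt this hn
      exact lt_tsub_iff_left.1 h2
    have hN2 : c + 1 ≤ N := hm.trans (by exact_mod_cast le_max_right n m)
    have hpow : (1 : ℝ≥0) ≤ 2 ^ N := one_le_pow₀ (by norm_num)
    have hpos : (0 : ℝ≥0) < 2 ^ N := by positivity
    let K := ⌊c * 2 ^ N⌋₊ + 1
    have hK1 : c * 2 ^ N < K := by
      simpa [K] using Nat.lt_floor_add_one (c * 2 ^ N)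
    have hK2 : (K : ℝ≥0) ≤ c * 2 ^ N + 1 := by
      have := Nat.floor_le (show (0 : ℝ≥0) ≤ c * 2 ^ N from zero_le)
      simpa [K] using this
    have hK3 : K ≤ N * 2 ^ N := by
      have : (K : ℝ≥0) ≤ ((N * 2 ^ N : ℕ) : ℝ≥0) := by
        push_cast
        calc (K : ℝ≥0) ≤ c * 2 ^ N + 1 := hK2
          _ ≤ c * 2 ^ N + 2 ^ N := by gcongr
          _ = (c + 1) * 2 ^ N := by ring
          _ ≤ N * 2 ^ N := by gcongr
      exact_mod_cast this
    refine lt_of_lt_of_le ?_ (le_iSup (fun N => step h hh N (N * 2 ^ N) x) N)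
    refine lt_of_lt_of_le ?_ (Finset.sum_le_sum_of_subset (Finset.range_mono hK3))
    rw [Finset.sum_congr rfl (g := fun _ => (((2 ^ N)⁻¹ : ℝ≥0) : ℝ≥0∞))]
    · rw [Finset.sum_const, Finset.card_range, nsmul_eq_mul]
      have : c < K * (2 ^ N)⁻¹ := by
        rw [← div_eq_mul_inv, lt_div_iff₀ hpos]; exact hK1
      exact_mod_cast this
    · intro j hj
      apply indicator_of_mem
      refine lt_of_le_of_lt (ENNReal.coe_le_coe.2 ?_) hd
      have hjK : ((j + 1 : ℕ) : ℝ≥0) ≤ K := by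
        exact_mod_cast Finset.mem_range.1 hj
      calc ((j + 1 : ℕ) : ℝ≥0) * (2 ^ N)⁻¹ ≤ (c * 2 ^ N + 1) * (2 ^ N)⁻¹ := by
            gcongr; exact hjK.trans hK2
        _ = c + (2 ^ N)⁻¹ := by field_simp
        _ ≤ d := hN1.le
  · refine iSup_le fun N => ?_
    have hgen : ∀ M, step h hh N M x ≤ h x ∧
        step h hh N M x ≤ ((M * (2 ^ N)⁻¹ : ℝ≥0) : ℝ≥0∞) := by
      intro M
      induction M with
      | zero => simp [step]
      | succ M ih =>
        have e : step h hh N (M + 1) x = step h hh N M x +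
            (superlevel h hh (((M + 1 : ℕ) * (2 ^ N)⁻¹ : ℝ≥0) : ℝ≥0∞) : Set X).indicator
              (fun _ => (((2 ^ N)⁻¹ : ℝ≥0) : ℝ≥0∞)) x := by
          rw [step, Finset.sum_range_succ]; rfl
        have e2 : ((((M + 1 : ℕ) : ℝ≥0) * (2 ^ N)⁻¹ : ℝ≥0) : ℝ≥0∞)
            = ((M * (2 ^ N)⁻¹ : ℝ≥0) : ℝ≥0∞) + (((2 ^ N)⁻¹ : ℝ≥0) : ℝ≥0∞) := by
          rw [← ENNReal.coe_add]; congr 1; push_cast; ring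
        have hb : step h hh N (M + 1) x
            ≤ ((((M + 1 : ℕ) : ℝ≥0) * (2 ^ N)⁻¹ : ℝ≥0) : ℝ≥0∞) := by
          rw [e, e2]
          exact add_le_add ih.2 (indicator_apply_le' (fun _ => le_rfl) fun _ => zero_le)
        refine ⟨?_, hb⟩
        by_cases hx : x ∈ superlevel h hh (((M + 1 : ℕ) * (2 ^ N)⁻¹ : ℝ≥0) : ℝ≥0∞)
        · exact hb.trans (le_of_lt hx)
        · rw [e, indicator_of_notMem (by simpa using hx), add_zero]
          exact ih.1
    exact (hgen _).1

theorem integral_eq_iSup (μ : PointValuation X) (h : X → ℝ≥0∞) (hh : LowerSemicontinuous h) :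
    μ.integral h hh = ⨆ N : ℕ, ∑ j ∈ Finset.range (N * 2 ^ N), (((2 ^ N)⁻¹ : ℝ≥0) : ℝ≥0∞) *
      μ (superlevel h hh (((j + 1 : ℕ) * (2 ^ N)⁻¹ : ℝ≥0) : ℝ≥0∞)) := by
  rw [μ.integral_iSup (monotone_step h hh) (fun N => lowerSemicontinuous_step_sum h hh N _) hh
    (iSup_step h hh)]
  exact iSup_congr fun N => μ.integral_step_sum h hh N _

theorem integral_add (μ : PointValuation X) {f h : X → ℝ≥0∞} (hf : LowerSemicontinuous f)
    (hh : LowerSemicontinuous h) :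
    μ.integral (fun x => f x + h x) (hf.add hh) = μ.integral f hf + μ.integral h hh := by
  rw [μ.integral_iSup (h := fun N x => f x + step h hh N (N * 2 ^ N) x)
    (fun m n hmn x => add_le_add le_rfl (monotone_step h hh hmn x))
    (fun N => hf.add (lowerSemicontinuous_step_sum h hh N _)) (hf.add hh)
    (fun x => by rw [iSup_step h hh x, ENNReal.add_iSup]), μ.integral_eq_iSup h hh,
    ENNReal.add_iSup]
  exact iSup_congr fun N => μ.integral_add_step_sum f hf h hh N _

/-! ### The monad structure -/

theorem lowerSemicontinuous_eval {f : X → PointValuation Y} (hf : Continuous f) (U : Opens Y) :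
    LowerSemicontinuous fun x => f x U := by
  rw [lowerSemicontinuous_iff_isOpen_preimage]
  intro r
  induction r with
  | top => simp
  | coe r => exact (isOpen_generateFrom_of_mem ⟨U, r, rfl⟩ :
      IsOpen {ν : PointValuation Y | (r : ℝ≥0∞) < ν U}).preimage hf

/-- The extension `f† : μ ↦ (U ↦ ∫ f(x)(U) dμ(x))` of a continuous map from `X` to the space of
point-continuous valuations on `Y`. -/
def extend (f : X → PointValuation Y) (hf : Continuous f) (μ : PointValuation X) :
    PointValuation Y where
  toFun U := μ.integral (fun x => f x U) (lowerSemicontinuous_eval hf U)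
  strict := by
    rw [← μ.integral_zero]
    exact μ.integral_congr (by ext x; exact (f x).strict) _ _
  mono _ _ h := μ.integral_mono (fun x => (f x).mono h) _ _
  modular U V := by
    rw [← integral_add, ← integral_add]
    exact μ.integral_congr (by ext x; exact (f x).modular U V) _ _
  pointContinuous := by
    let := pointTopology Y
    simp only [integral_eq_iSup]
    refine lowerSemicontinuous_iSup fun N => lowerSemicontinuous_sum fun j _ => ?_
    refine (ENNReal.continuous_const_mul ENNReal.coe_ne_top).comp_lowerSemicontinuous ?_
      fun _ _ h => mul_le_mul_right h _
    refine lowerSemicontinuous_of_finite fun U r hr => ?_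
    obtain ⟨F, hF, hFU, hV⟩ := μ.exists_finite hr
    choose! G hG hGU hGV using fun x (hx : x ∈ F) => (f x).exists_finite (hFU hx)
    refine ⟨⋃ x ∈ F, G x, hF.biUnion hG, iUnion₂_subset hGU, fun V hGW => hV _ ?_⟩
    exact fun x hx => hGV x hx V ((subset_biUnion_of_mem (u := G) hx).trans hGW)

/-- The multiplication of the monad at `X`, that is, the extension of the identity:
`mult ϖ U = ∫ μ(U) dϖ(μ)`. -/
def mult (ϖ : PointValuation (PointValuation X)) : PointValuation X :=
  extend id continuous_id ϖ

end PointValuation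

/-- `(X, α)` is an (Eilenberg-Moore) algebra of the monad of point-continuous valuations:
`α` is a morphism, that is, a continuous map, `α ∘ η = id`, and `α ∘ m` is the composition of `α`
with the image map of `α`. -/
def IsPointValuationAlgebra {X : Type*} [TopologicalSpace X] (α : PointValuation X → X) : Prop :=
  ∃ hα : Continuous α, (∀ x : X, α (PointValuation.dirac x) = x) ∧
    ∀ ϖ : PointValuation (PointValuation X),
      α (PointValuation.mult ϖ) = α (PointValuation.map α hα ϖ)

/-! ### Topological cones

A cone is a module over the semiring `ℝ≥0`. -/

/-- A topological cone: a cone with a `T₀` topology that makes addition and scalar multiplication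
jointly continuous, where the scalars carry the Scott topology. -/
structure IsTopologicalCone (C : Type*) [TopologicalSpace C] [AddCommMonoid C] [Module ℝ≥0 C] :
    Prop where
  t0 : T0Space C
  continuous_add : Continuous fun p : C × C => p.1 + p.2
  continuous_smul : Continuous fun p : Topology.WithScott ℝ≥0 × C =>
    Topology.WithScott.ofScott p.1 • p.2

/-- Every neighbourhood of a point contains a convex, not necessarily open, neighbourhood. -/
def IsWeaklyLocallyConvex (C : Type*) [TopologicalSpace C] [AddCommMonoid C] [Module ℝ≥0 C] :
    Prop :=
  ∀ (x : C) (U : Set C), IsOpen U → x ∈ U → ∃ A ∈ nhds x, A ⊆ U ∧ Convex ℝ≥0 A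

/-- A space is sober if every irreducible closed subset is the closure of a unique point. -/
def IsSober (X : Type*) [TopologicalSpace X] : Prop :=
  T0Space X ∧ QuasiSober X

/-- `b` is a (Choquet) barycentre of `ν`: `Λ b = ∫ Λ dν` for every lower semicontinuous linear map
`Λ : C → [0, ∞]`. -/
def IsBarycentre {C : Type*} [TopologicalSpace C] [AddCommMonoid C] [Module ℝ≥0 C]
    (ν : PointValuation C) (b : C) : Prop :=
  ∀ (Λ : C →ₗ[ℝ≥0] ℝ≥0∞) (hΛ : LowerSemicontinuous Λ), Λ b = ν.integral Λ hΛ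

end

/-! The space of valuations is itself a sober, locally convex topological cone, and both halves
transfer structure between it and the given space through Dirac masses.

An algebra `α` exhibits `X` as a retract of the space of valuations, with section `dirac`.
Evaluating the multiplication law at `dirac μ + dirac ν` and at `r • dirac μ` shows that `α`
respects the induced operations, so the cone axioms descend along the surjection `α`. Sobriety
passes to retracts. Images under `α` of convex neighbourhoods are convex neighbourhoods, but need
not be open, which is why local convexity is only weak.

Conversely, in a cone `C` the value of `α` at a simple valuation is forced to be the corresponding
linear combination. Two facts extend it to all valuations. First, every open neighbourhood of `μ`
contains a simple valuation below `μ` (`exists_specializes_simple`); hence continuous maps are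
determined by their values at simple valuations, which gives uniqueness, linearity, the algebra law
and the barycentre property. Second, the linear combination depends continuously on the simple
valuation (`exists_isOpen_simple`). If `simple b` has almost as much mass as `simple a` on every
union of chosen neighbourhoods of the support points of `a`, then Hall's condition holds, and mass
of `b` can be transported to these points; convexity gathers the mass received by one point into one
nearby point, and surplus mass only moves the sum up. By sobriety, `α μ` is then the generic point
of the closure of the combinations coming from simple valuations below `μ`.

Both facts rest on finite submodular functions: a polymatroid base yields simple valuations below
`μ`, and also proves the transport theorem. -/

/-! ### Finite polymatroids and transport -/

/-- The greedy algorithm: a monotone submodular set function has a base on every finite set. -/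
theorem exists_base_of_submodular {κ : Type*} [DecidableEq κ] {c : Finset κ → ℝ} (h0 : c ∅ = 0)
    (hm : Monotone c) (hs : ∀ A B, c (A ∪ B) + c (A ∩ B) ≤ c A + c B) (F : Finset κ) :
    ∃ t : κ → ℝ≥0, (∀ x ∉ F, t x = 0) ∧ ∑ x ∈ F, (t x : ℝ) = c F ∧
      ∀ A ⊆ F, ∑ x ∈ A, (t x : ℝ) ≤ c A := by
  induction F using Finset.induction_on with
  | empty =>
    refine ⟨0, by simp, by simp [h0], fun A hA => ?_⟩
    simp [Finset.subset_empty.1 hA, h0]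
  | insert x F hx ih =>
    obtain ⟨t, ht0, htF, htA⟩ := ih
    have hd : 0 ≤ c (insert x F) - c F := sub_nonneg.2 (hm (Finset.subset_insert x F))
    -- The new element receives its marginal gain, so that the total over the enlarged set stays
    -- tight.
    let t' := Function.update t x (c (insert x F) - c F).toNNReal
    have hx' : (t' x : ℝ) = c (insert x F) - c F := by simp [t', hd]
    have hsum : ∀ A, x ∉ A → ∑ y ∈ A, (t' y : ℝ) = ∑ y ∈ A, (t y : ℝ) := fun A hA =>
      Finset.sum_congr rfl fun y hy => by
        rw [show t' y = t y from Function.update_of_ne (ne_of_mem_of_not_mem hy hA) _ _]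
    refine ⟨t', fun y hy => ?_, ?_, fun A hA => ?_⟩
    · rw [Finset.mem_insert, not_or] at hy
      rw [show t' y = t y from Function.update_of_ne hy.1 _ _, ht0 y hy.2]
    · rw [Finset.sum_insert hx, hsum F hx, hx', htF]; ring
    · by_cases hxA : x ∈ A
      · rw [← Finset.insert_erase hxA, Finset.sum_insert (Finset.notMem_erase x A),
          hsum _ (Finset.notMem_erase x A), hx', Finset.insert_erase hxA]
        -- Submodularity bounds the marginal gain of `x` over `F` by its marginal gain over the
        -- smaller set `A.erase x`.
        have h1 := hs F A
        have hu : F ∪ A = insert x F := by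
          ext y; simp only [Finset.mem_union, Finset.mem_insert]
          refine ⟨?_, ?_⟩
          · rintro (h | h)
            · exact Or.inr h
            · simpa using hA h
          · rintro (rfl | h)
            · exact Or.inr hxA
            · exact Or.inl h
        have hi : F ∩ A = A.erase x := by
          ext y; simp only [Finset.mem_inter, Finset.mem_erase]
          refine ⟨fun h => ⟨fun e => hx (e ▸ h.1), h.2⟩, fun h => ⟨?_, h.2⟩⟩
          exact (Finset.mem_insert.1 (hA h.2)).resolve_left h.1
        rw [hu, hi] at h1
        have h2 := htA (A.erase x) (hi ▸ Finset.inter_subset_left)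
        linarith
      · rw [hsum A hxA]
        exact htA A ((Finset.subset_insert_iff_of_notMem hxA).1 hA)

/-- Scaling a base down to total `p` only relaxes the bounds. They extend to all `A` because the
base vanishes off `F` and `c` is monotone. -/
theorem exists_sum_eq_of_submodular {κ : Type*} [DecidableEq κ] {c : Finset κ → ℝ} (h0 : c ∅ = 0)
    (hm : Monotone c) (hs : ∀ A B, c (A ∪ B) + c (A ∩ B) ≤ c A + c B) (F : Finset κ) {p : ℝ≥0}
    (hp : (p : ℝ) ≤ c F) :
    ∃ t : κ → ℝ≥0, (∀ x ∉ F, t x = 0) ∧ ∑ x ∈ F, t x = p ∧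
      ∀ A, ∑ x ∈ A, (t x : ℝ) ≤ c A := by
  obtain ⟨t, ht0, htF, htA⟩ := exists_base_of_submodular h0 hm hs F
  have htA' : ∀ A, ∑ x ∈ A, (t x : ℝ) ≤ c A := fun A => by
    refine le_trans (le_of_eq ?_) ((htA (A ∩ F) Finset.inter_subset_right).trans
      (hm Finset.inter_subset_left))
    refine (Finset.sum_subset Finset.inter_subset_left fun x hx hx' => ?_).symm
    rw [ht0 x fun h => hx' (Finset.mem_inter.2 ⟨hx, h⟩)]; rfl
  have hpt : p ≤ ∑ x ∈ F, t x := by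
    rw [← NNReal.coe_le_coe]; push_cast; rw [htF]; exact hp
  obtain hz | hz := eq_or_ne (∑ x ∈ F, t x) 0
  · exact ⟨t, ht0, by rw [hz] at hpt ⊢; exact (le_antisymm hpt zero_le).symm, htA'⟩
  · refine ⟨fun x => p / (∑ x ∈ F, t x) * t x, fun x hx => by simp [ht0 x hx], ?_, fun A => ?_⟩
    · rw [← Finset.mul_sum, div_mul_cancel₀ _ hz]
    · refine le_trans (Finset.sum_le_sum fun x _ => ?_) (htA' A)
      rw [NNReal.coe_le_coe]
      exact mul_le_of_le_one_left zero_le (div_le_one_of_le₀ hpt zero_le)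

/-- The weighted marriage theorem: supplies `q` meet demands `p` along the relation
`j ∈ N i` if every set of demands is covered by the supplies it is related to. -/
theorem exists_transport {ι κ : Type*} [DecidableEq ι] [DecidableEq κ] (N : ι → Finset κ)
    (p : ι → ℝ≥0) (I : Finset ι) (q : κ → ℝ≥0)
    (h : ∀ S ⊆ I, ∑ i ∈ S, p i ≤ ∑ j ∈ S.biUnion N, q j) :
    ∃ t : ι → κ → ℝ≥0, (∀ i ∈ I, ∀ j ∉ N i, t i j = 0) ∧ (∀ i ∈ I, ∑ j ∈ N i, t i j = p i) ∧
      ∀ j, ∑ i ∈ I, t i j ≤ q j := by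
  induction I using Finset.induction_on generalizing q with
  | empty => exact ⟨0, by simp, by simp, by simp⟩
  | insert i I hi ih =>
    let e (A : Finset κ) (S : Finset ι) : ℝ := ∑ j ∈ A ∪ S.biUnion N, (q j : ℝ) - ∑ k ∈ S, (p k : ℝ)
    have hne : I.powerset.Nonempty := ⟨∅, by simp⟩
    -- `c A` bounds how much supply may be taken from `A` for the new demand `i` without violating
    -- Hall's condition for the demands in `I`.
    let c (A : Finset κ) : ℝ := I.powerset.inf' hne (e A)
    have hce : ∀ A, ∀ S ⊆ I, c A ≤ e A S := fun A S hS =>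
      Finset.inf'_le _ (Finset.mem_powerset.2 hS)
    have hqm : ∀ {A B : Finset κ}, A ⊆ B → ∑ j ∈ A, (q j : ℝ) ≤ ∑ j ∈ B, (q j : ℝ) := fun hAB =>
      Finset.sum_le_sum_of_subset_of_nonneg hAB fun j _ _ => (q j).2
    have h' : ∀ S ⊆ insert i I, ∑ k ∈ S, (p k : ℝ) ≤ ∑ j ∈ S.biUnion N, (q j : ℝ) := fun S hS => by
      exact_mod_cast h S hS
    have h0 : c ∅ = 0 := by
      apply le_antisymm
      · simpa [e] using hce ∅ ∅ (Finset.empty_subset I)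
      · refine Finset.le_inf' _ _ fun S hS => ?_
        have := h' S ((Finset.mem_powerset.1 hS).trans (Finset.subset_insert i I))
        simpa [e] using this
    have hm : Monotone c := fun A B hAB => Finset.le_inf' _ _ fun S hS =>
      (hce A S (Finset.mem_powerset.1 hS)).trans
        (sub_le_sub_right (hqm (Finset.union_subset_union_left hAB)) _)
    have hs : ∀ A B, c (A ∪ B) + c (A ∩ B) ≤ c A + c B := fun A B => by
      obtain ⟨S, hS, hcS⟩ := Finset.exists_mem_eq_inf' hne (e A)
      obtain ⟨T, hT, hcT⟩ := Finset.exists_mem_eq_inf' hne (e B)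
      rw [Finset.mem_powerset] at hS hT
      change c A = _ at hcS
      change c B = _ at hcT
      -- Union and intersection of the minimisers for `A` and `B` compete for `A ∪ B` and `A ∩ B`;
      -- the demand terms are modular and the neighbourhood terms submodular.
      have h1 := hce (A ∪ B) (S ∪ T) (Finset.union_subset hS hT)
      have h2 := hce (A ∩ B) (S ∩ T) (Finset.inter_subset_left.trans hS)
      have h3 := Finset.sum_union_inter (s₁ := S) (s₂ := T) (f := fun k => (p k : ℝ))
      have h4 := Finset.sum_union_inter (s₁ := A ∪ S.biUnion N) (s₂ := B ∪ T.biUnion N)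
        (f := fun k => (q k : ℝ))
      have h5 : ∑ j ∈ (A ∪ B) ∪ (S ∪ T).biUnion N, (q j : ℝ) ≤
          ∑ j ∈ (A ∪ S.biUnion N) ∪ (B ∪ T.biUnion N), (q j : ℝ) := hqm fun j => by
        simp only [Finset.mem_union, Finset.mem_biUnion]; grind
      have h6 : ∑ j ∈ (A ∩ B) ∪ (S ∩ T).biUnion N, (q j : ℝ) ≤
          ∑ j ∈ (A ∪ S.biUnion N) ∩ (B ∪ T.biUnion N), (q j : ℝ) := hqm fun j => by
        simp only [Finset.mem_union, Finset.mem_biUnion, Finset.mem_inter]; grind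
      simp only [e] at h1 h2 hcS hcT
      linarith
    -- This is Hall's condition for the sets `insert i S`.
    have hp : (p i : ℝ) ≤ c (N i) := Finset.le_inf' _ _ fun S hS => by
      rw [Finset.mem_powerset] at hS
      have := h' (insert i S) (Finset.insert_subset_insert i hS)
      rw [Finset.sum_insert fun h => hi (hS h), Finset.biUnion_insert] at this
      simp only [e]
      linarith
    obtain ⟨t, ht0, htp, htA⟩ := exists_sum_eq_of_submodular h0 hm hs (N i) hp
    have htq : ∀ j, t j ≤ q j := fun j => by
      have := (htA {j}).trans (hce {j} ∅ (Finset.empty_subset I))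
      simpa [e] using this
    -- The bound of `t` by `c` on `S.biUnion N` says that the remaining supply `q - t` satisfies
    -- Hall's condition for `S`.
    obtain ⟨u, hu0, hup, huq⟩ := ih (fun j => q j - t j) fun S hS => by
      have h1 := (htA (S.biUnion N)).trans (hce (S.biUnion N) S hS)
      simp only [e, Finset.union_self] at h1
      rw [← NNReal.coe_le_coe]
      push_cast
      rw [Finset.sum_congr rfl fun j _ => NNReal.coe_sub (htq j), Finset.sum_sub_distrib]
      linarith
    have hne' : ∀ k ∈ I, k ≠ i := fun k hk e => hi (e ▸ hk)
    refine ⟨Function.update u i t, fun k hk j hj => ?_, fun k hk => ?_, fun j => ?_⟩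
    · obtain rfl | hk := Finset.mem_insert.1 hk
      · simpa using ht0 j hj
      · rw [Function.update_of_ne (hne' k hk)]
        exact hu0 k hk j hj
    · obtain rfl | hk := Finset.mem_insert.1 hk
      · simpa using htp
      · rw [Function.update_of_ne (hne' k hk)]
        exact hup k hk
    · rw [Finset.sum_insert hi, Finset.sum_congr rfl
        fun k hk => by rw [Function.update_of_ne (hne' k hk)], Function.update_self]
      calc t j + ∑ k ∈ I, u k j ≤ t j + (q j - t j) := by gcongr; exact huq j
        _ = q j := add_tsub_cancel_of_le (htq j)

/-! ### The topology of the space of point-continuous valuations -/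

namespace PointValuation

variable {X Y : Type*} [TopologicalSpace X] [TopologicalSpace Y]

theorem isOpen_setOf_lt (U : Opens X) (r : ℝ≥0) :
    IsOpen {μ : PointValuation X | (r : ℝ≥0∞) < μ U} :=
  isOpen_generateFrom_of_mem ⟨U, r, rfl⟩

theorem continuous_iff_forall_lowerSemicontinuous {f : Y → PointValuation X} :
    Continuous f ↔ ∀ U, LowerSemicontinuous fun y => f y U := by
  refine ⟨lowerSemicontinuous_eval, fun h => continuous_generateFrom_iff.2 ?_⟩
  rintro _ ⟨U, r, rfl⟩
  exact (h U).isOpen_preimage r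

theorem lowerSemicontinuous_apply (U : Opens X) :
    LowerSemicontinuous fun μ : PointValuation X => μ U :=
  lowerSemicontinuous_eval continuous_id U

/-- Basic neighbourhoods in the weak topology. -/
theorem exists_finset_of_mem_isOpen {W : Set (PointValuation X)} (hW : IsOpen W)
    {μ : PointValuation X} (hμ : μ ∈ W) :
    ∃ T : Finset (Opens X × ℝ≥0), (∀ p ∈ T, (p.2 : ℝ≥0∞) < μ p.1) ∧
      ∀ ν : PointValuation X, (∀ p ∈ T, (p.2 : ℝ≥0∞) < ν p.1) → ν ∈ W := by
  classical
  obtain ⟨_, ⟨S, ⟨hS, hSs⟩, rfl⟩, hμS, hsub⟩ :=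
    (isTopologicalBasis_of_subbasis (α := PointValuation X) rfl).exists_subset_of_mem_open hμ hW
  choose! u r hur using fun s (hs : s ∈ S) => hSs hs
  refine ⟨hS.toFinset.image fun s => (u s, r s), fun p hp => ?_, fun ν hν => hsub ?_⟩
  · obtain ⟨s, hs, rfl⟩ := Finset.mem_image.1 hp
    have hs := hS.mem_toFinset.1 hs
    have := hμS s hs
    rwa [hur s hs] at this
  · intro s hs
    rw [hur s hs]
    exact hν (u s, r s) (Finset.mem_image.2 ⟨s, hS.mem_toFinset.2 hs, rfl⟩)

/-- Larger valuations specialize to smaller ones: `μ ⤳ ν` places `ν` below `μ`, and open sets are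
upper sets. -/
theorem specializes_iff {μ ν : PointValuation X} : μ ⤳ ν ↔ ∀ U, ν U ≤ μ U := by
  refine ⟨fun h U => le_of_forall_lt fun r hr => ?_, fun h => ?_⟩
  · lift r to ℝ≥0 using hr.ne_top
    exact h.mem_open (isOpen_setOf_lt U r) hr
  · refine specializes_iff_forall_open.2 fun W hW hν => ?_
    obtain ⟨T, hT, hTW⟩ := exists_finset_of_mem_isOpen hW hν
    exact hTW μ fun p hp => (hT p hp).trans_le (h p.1)

instance : T0Space (PointValuation X) where
  t0 μ ν h := by
    ext U
    exact le_antisymm (specializes_iff.1 h.specializes' U) (specializes_iff.1 h.specializes U)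

theorem continuous_dirac : Continuous (dirac : X → PointValuation X) := by
  classical
  refine continuous_iff_forall_lowerSemicontinuous.2 fun U => ?_
  convert U.isOpen.lowerSemicontinuous_indicator (y := (1 : ℝ≥0∞)) zero_le with x
  by_cases hx : x ∈ U <;> simp [dirac, hx]

instance : ContinuousAdd (PointValuation X) where
  continuous_add := continuous_iff_forall_lowerSemicontinuous.2 fun U =>
    ((lowerSemicontinuous_apply U).comp continuous_fst).add
      ((lowerSemicontinuous_apply U).comp continuous_snd)

theorem isOpen_ofScott_preimage_Ioi (r : ℝ≥0) :
    IsOpen (Topology.WithScott.ofScott ⁻¹' Ioi r) := by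
  have : (Topology.WithScott.ofScott ⁻¹' Ioi r : Set (Topology.WithScott ℝ≥0)) =
      (Iic (Topology.WithScott.toScott r))ᶜ := by
    ext s; exact (not_le (α := ℝ≥0)).symm
  rw [this]
  exact isClosed_Iic.isOpen_compl

theorem lowerSemicontinuous_coe_ofScott : LowerSemicontinuous
    fun r : Topology.WithScott ℝ≥0 => ((Topology.WithScott.ofScott r : ℝ≥0) : ℝ≥0∞) := by
  rw [lowerSemicontinuous_iff_isOpen_preimage]
  intro s
  induction s with
  | top => simp
  | coe s =>
    convert isOpen_ofScott_preimage_Ioi s using 1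
    ext t; simp

theorem continuous_scott_smul : Continuous fun p : Topology.WithScott ℝ≥0 × PointValuation X =>
    Topology.WithScott.ofScott p.1 • p.2 := by
  refine continuous_iff_forall_lowerSemicontinuous.2 fun U => ?_
  intro p r hr
  change r < ((Topology.WithScott.ofScott p.1 : ℝ≥0) : ℝ≥0∞) * p.2 U at hr
  -- A product in `[0, ∞]` is the supremum of the products of strictly smaller factors, also when it
  -- is `0 * ∞`.
  obtain ⟨a, ha, b, hb, hab⟩ : ∃ a < ((Topology.WithScott.ofScott p.1 : ℝ≥0) : ℝ≥0∞),
      ∃ b < p.2 U, r ≤ a * b := by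
    by_contra! h
    exact absurd hr (not_lt.2 (ENNReal.mul_le_of_forall_lt fun a ha b hb => (h a ha b hb).le))
  filter_upwards [(lowerSemicontinuous_coe_ofScott.comp continuous_fst) p a ha,
    ((lowerSemicontinuous_apply U).comp continuous_snd) p b hb] with q hq1 hq2
  exact hab.trans_lt (ENNReal.mul_lt_mul hq1 hq2)

theorem continuous_const_smul (r : ℝ≥0) : Continuous fun μ : PointValuation X => r • μ :=
  continuous_scott_smul.comp (Continuous.prodMk_right (Topology.WithScott.toScott r))

/-- Irreducibility makes a closed set `S` behave like a directed set: finitely many strict lower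
bounds attained separately in `S` are attained by one member. Hence the pointwise supremum of `S` is
modular and lies in `S`, and it is the generic point. -/
theorem isSober : IsSober (PointValuation X) := by
  refine ⟨inferInstance, ⟨fun {S} hS hSc => ?_⟩⟩
  have key : ∀ T : Finset (Opens X × ℝ≥0), (∀ p ∈ T, ∃ ν ∈ S, (p.2 : ℝ≥0∞) < ν p.1) →
      ∃ ν ∈ S, ∀ p ∈ T, (p.2 : ℝ≥0∞) < ν p.1 := by
    classical
    intro T hT
    have := isIrreducible_iff_sInter.1 hS
      (T.image fun p => {ν : PointValuation X | (p.2 : ℝ≥0∞) < ν p.1}) (by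
        simp only [Finset.mem_image]
        rintro _ ⟨p, -, rfl⟩
        exact isOpen_setOf_lt _ _) (by
        simp only [Finset.mem_image]
        rintro _ ⟨p, hp, rfl⟩
        exact hT p hp)
    obtain ⟨ν, hν, h⟩ := this
    refine ⟨ν, hν, fun p hp => h _ (Finset.mem_coe.2 (Finset.mem_image_of_mem _ hp))⟩
  have key2 : ∀ (U V : Opens X) (r s : ℝ≥0∞), r < ⨆ ν ∈ S, ν.toFun U → s < ⨆ ν ∈ S, ν.toFun V →
      ∃ ν ∈ S, r < ν.toFun U ∧ s < ν.toFun V := by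
    classical
    intro U V r s hr hs
    lift r to ℝ≥0 using hr.ne_top
    lift s to ℝ≥0 using hs.ne_top
    simp only [lt_iSup_iff, exists_prop] at hr hs
    obtain ⟨ν, hν, h⟩ := key {(U, r), (V, s)} (by simpa using ⟨hr, hs⟩)
    exact ⟨ν, hν, by simpa using h⟩
  have hle : ∀ ν ∈ S, ∀ U, ν.toFun U ≤ ⨆ ν ∈ S, ν.toFun U := fun ν hν U =>
    le_iSup₂ (f := fun (ν : PointValuation X) (_ : ν ∈ S) => ν.toFun U) ν hν
  have hadd : ∀ U V A B : Opens X, (∀ ν : PointValuation X, ν U + ν V = ν A + ν B) →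
      (⨆ ν ∈ S, ν.toFun U) + (⨆ ν ∈ S, ν.toFun V) ≤
        (⨆ ν ∈ S, ν.toFun A) + (⨆ ν ∈ S, ν.toFun B) := by
    intro U V A B h
    have hν : ∀ ν ∈ S, ν.toFun U + ν.toFun V ≤
        (⨆ ν ∈ S, ν.toFun A) + (⨆ ν ∈ S, ν.toFun B) := fun ν hν =>
      (h ν).le.trans (add_le_add (hle ν hν A) (hle ν hν B))
    -- If one supremum is `0`, nothing lies strictly below it, so the approximation used afterwards
    -- is unavailable.
    obtain hU | hU := eq_or_ne (⨆ ν ∈ S, ν.toFun U) 0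
    · rw [hU, zero_add]
      exact iSup₂_le fun ν h => le_add_self.trans (hν ν h)
    obtain hV | hV := eq_or_ne (⨆ ν ∈ S, ν.toFun V) 0
    · rw [hV, add_zero]
      exact iSup₂_le fun ν h => le_self_add.trans (hν ν h)
    by_contra! hlt
    obtain ⟨r, hr, s, hs, hrs⟩ := ENNReal.exists_lt_add_of_lt_add hlt hU hV
    obtain ⟨ν, h, hr, hs⟩ := key2 U V r s hr hs
    exact absurd ((add_le_add hr.le hs.le).trans (hν ν h)) (not_le.2 hrs)
  let μ : PointValuation X :=
    { toFun := fun U => ⨆ ν ∈ S, ν.toFun U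
      strict := by simp [strict]
      mono := fun U V h => iSup₂_mono fun ν _ => ν.mono h
      modular := fun U V => le_antisymm (hadd _ _ _ _ fun ν => ν.modular U V)
        (hadd _ _ _ _ fun ν => (ν.modular U V).symm)
      pointContinuous := by
        let := pointTopology X
        exact lowerSemicontinuous_iSup fun ν => lowerSemicontinuous_iSup fun _ =>
          ν.pointContinuous }
  refine ⟨μ, ?_⟩
  rw [isGenericPoint_iff_specializes]
  refine fun ν => ⟨fun h => ?_, fun hν => specializes_iff.2 (hle ν hν)⟩
  have hμ : μ ∈ S := by
    rw [← hSc.closure_eq, mem_closure_iff]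
    intro W hW hμW
    obtain ⟨T, hT, hTW⟩ := exists_finset_of_mem_isOpen hW hμW
    obtain ⟨κ, hκ, h⟩ := key T fun p hp => by simpa [μ, lt_iSup_iff] using hT p hp
    exact ⟨κ, hTW κ h, hκ⟩
  exact h.mem_closed hSc hμ

end PointValuation

/-! ### Simple valuations and their density -/

namespace PointValuation

variable {X Y : Type*} [TopologicalSpace X] [TopologicalSpace Y]

/-- The simple valuation `∑ a x • δ_x` given by a finitely supported weight function. -/
noncomputable def simple : (X →₀ ℝ≥0) →ₗ[ℝ≥0] PointValuation X :=
  Finsupp.linearCombination ℝ≥0 dirac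

/-- Evaluation at an open set, as a linear map. -/
noncomputable def evalₗ (U : Opens X) : PointValuation X →ₗ[ℝ≥0] ℝ≥0∞ where
  toFun μ := μ U
  map_add' _ _ := rfl
  map_smul' _ _ := rfl

theorem simple_single (x : X) (r : ℝ≥0) : simple (Finsupp.single x r) = r • dirac x :=
  Finsupp.linearCombination_single ..

theorem dirac_eq_simple (x : X) : dirac x = simple (Finsupp.single x 1) := by
  rw [simple_single, one_smul]

open Classical in
theorem simple_apply {a : X →₀ ℝ≥0} {F : Finset X} (hF : a.support ⊆ F) (U : Opens X) :
    simple a U = ∑ x ∈ F with x ∈ U, (a x : ℝ≥0∞) := by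
  change evalₗ U (simple a) = _
  rw [simple, Finsupp.linearCombination_apply, Finsupp.sum_of_support_subset a hF _ (by simp),
    map_sum, Finset.sum_filter]
  refine Finset.sum_congr rfl fun x _ => ?_
  simp [evalₗ, dirac]

theorem simple_top {a : X →₀ ℝ≥0} {F : Finset X} (hF : a.support ⊆ F) :
    simple a ⊤ = ∑ x ∈ F, (a x : ℝ≥0∞) := by
  simp [simple_apply hF]

theorem simple_apply_ne_top (a : X →₀ ℝ≥0) (U : Opens X) : simple a U ≠ ∞ := by
  rw [simple_apply subset_rfl]
  exact ENNReal.sum_ne_top.2 fun _ _ => ENNReal.coe_ne_top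

theorem simple_apply_of_support_subset {a : X →₀ ℝ≥0} {U : Opens X} (h : ↑a.support ⊆ (U : Set X)) :
    simple a U = simple a ⊤ := by
  classical
  rw [simple_top subset_rfl, simple_apply subset_rfl,
    Finset.filter_true_of_mem fun x hx => SetLike.mem_coe.1 (h hx)]

/-- Approximation from below, by simple valuations, of the mass of one open set. -/
theorem exists_simple_le_of_lt (μ : PointValuation X) {U : Opens X} {r : ℝ≥0}
    (hr : (r : ℝ≥0∞) < μ U) :
    ∃ a : X →₀ ℝ≥0, ↑a.support ⊆ (U : Set X) ∧ (∀ V, simple a V ≤ μ V) ∧ simple a ⊤ = r := by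
  classical
  obtain ⟨F, hF, hFU, hFV⟩ := μ.exists_finite hr
  lift F to Finset X using hF
  -- The outer mass of a finite set, truncated at `r`: the truncation keeps it finite and makes the
  -- total mass exactly `r`. A base of `d` on `F` provides the weights.
  let d (A : Finset X) : ℝ≥0∞ := ⨅ V : {V : Opens X // ↑A ⊆ (V : Set X)}, min (μ V.1) r
  have hne : ∀ A : Finset X, Nonempty {V : Opens X // ↑A ⊆ (V : Set X)} := fun A =>
    ⟨⟨⊤, subset_univ _⟩⟩
  have hd : ∀ (A : Finset X) (V : Opens X), ↑A ⊆ (V : Set X) → d A ≤ min (μ V) r :=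
    fun A V h => iInf_le (fun V : {V : Opens X // ↑A ⊆ (V : Set X)} => min (μ V.1) r) ⟨V, h⟩
  have hdt : ∀ A, d A ≠ ∞ := fun A => ne_top_of_le_ne_top ENNReal.coe_ne_top
    ((hd A ⊤ (subset_univ _)).trans (min_le_right _ _))
  have hdm : Monotone d := fun A B hAB => le_iInf fun V =>
    hd A V.1 ((Finset.coe_subset.2 hAB).trans V.2)
  have hds : ∀ A B, d (A ∪ B) + d (A ∩ B) ≤ d A + d B := fun A B => by
    refine ENNReal.le_iInf_add_iInf fun V W => ?_
    have h1 := hd (A ∪ B) (V.1 ⊔ W.1) (by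
      simpa using union_subset_union V.2 W.2)
    have h2 := hd (A ∩ B) (V.1 ⊓ W.1) (by
      simpa using inter_subset_inter V.2 W.2)
    refine (add_le_add h1 h2).trans ?_
    have hm := μ.modular V.1 W.1
    have hiV : μ (V.1 ⊓ W.1) ≤ μ V.1 := μ.mono inf_le_left
    have hiW : μ (V.1 ⊓ W.1) ≤ μ W.1 := μ.mono inf_le_right
    -- Truncating a monotone modular function at `r` leaves it submodular.
    obtain h | h := le_total (r : ℝ≥0∞) (μ V.1)
    · rw [min_eq_right h]
      exact add_le_add (min_le_right _ _) (min_le_min_right _ hiW)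
    obtain h' | h' := le_total (r : ℝ≥0∞) (μ W.1)
    · rw [min_eq_right h', add_comm (min (μ V.1) _)]
      exact add_le_add (min_le_right _ _) (min_le_min_right _ hiV)
    rw [min_eq_left h, min_eq_left h', hm]
    exact add_le_add (min_le_left _ _) (min_le_left _ _)
  have hd0 : d ∅ = 0 := by
    have := hd ∅ ⊥ (by simp)
    rw [μ.strict] at this
    simpa using this
  have hdF : d F = r := le_antisymm ((hd F ⊤ (subset_univ _)).trans (min_le_right _ _))
    (le_iInf fun V => le_min (hFV V.1 V.2).le le_rfl)
  obtain ⟨t, ht0, htF, htA⟩ := exists_sum_eq_of_submodular (c := fun A => (d A).toReal)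
    (by simp [hd0]) (fun A B h => ENNReal.toReal_mono (hdt B) (hdm h))
    (fun A B => by
      rw [← ENNReal.toReal_add (hdt _) (hdt _), ← ENNReal.toReal_add (hdt _) (hdt _)]
      exact ENNReal.toReal_mono (ENNReal.add_ne_top.2 ⟨hdt _, hdt _⟩) (hds A B)) F
    (p := r) (by simp [hdF])
  let a : X →₀ ℝ≥0 := Finsupp.onFinset F t fun x hx => by
    by_contra h
    exact hx (ht0 x h)
  have hsupp : a.support ⊆ F := Finsupp.support_onFinset_subset
  refine ⟨a, (Finset.coe_subset.2 hsupp).trans hFU, fun V => ?_, ?_⟩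
  · rw [simple_apply hsupp]
    have h1 := htA (F.filter (· ∈ V))
    have h2 : ∑ x ∈ F with x ∈ V, (a x : ℝ≥0∞) ≤ d (F.filter (· ∈ V)) := by
      rw [← ENNReal.ofNNReal_finsetSum, ← ENNReal.ofReal_coe_nnreal, NNReal.coe_sum]
      exact ENNReal.ofReal_le_of_le_toReal h1
    exact h2.trans ((hd _ V fun x hx => (Finset.mem_filter.1 hx).2).trans (min_le_left _ _))
  · rw [simple_top hsupp, ← ENNReal.ofNNReal_finsetSum]
    exact congrArg _ htF

/-- The restriction of a valuation to an open set. -/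
noncomputable def restrict (μ : PointValuation X) (G : Opens X) : PointValuation X where
  toFun W := μ (W ⊓ G)
  strict := by simp [μ.strict]
  mono _ _ h := μ.mono (inf_le_inf_right G h)
  modular U V := by
    rw [μ.modular, inf_sup_right, inf_inf_distrib_right U V G]
  pointContinuous := lowerSemicontinuous_of_finite fun U r hr => by
    obtain ⟨F, hF, hFU, hV⟩ := μ.exists_finite hr
    exact ⟨F, hF, fun x hx => (hFU hx).1, fun V hFV => hV _ fun x hx => ⟨hFV hx, (hFU hx).2⟩⟩

/-- The restriction of a valuation to the complement of an open set of finite mass. -/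
noncomputable def corestrict (μ : PointValuation X) (G : Opens X) (hG : μ G ≠ ∞) :
    PointValuation X where
  toFun W := μ (W ⊔ G) - μ G
  strict := by simp
  mono _ _ h := tsub_le_tsub_right (μ.mono (sup_le_sup_right h G)) _
  modular U V := by
    have h : ∀ W, μ G ≤ μ (W ⊔ G) := fun W => μ.mono le_sup_right
    have hm := μ.modular (U ⊔ G) (V ⊔ G)
    rw [← sup_sup_distrib_right, ← sup_inf_right] at hm
    rw [← ENNReal.add_left_inj hG, ← ENNReal.add_left_inj hG]
    calc μ (U ⊔ G) - μ G + (μ (V ⊔ G) - μ G) + μ G + μ G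
        = (μ (U ⊔ G) - μ G + μ G) + (μ (V ⊔ G) - μ G + μ G) := by ring
      _ = (μ (U ⊔ V ⊔ G) - μ G + μ G) + (μ (U ⊓ V ⊔ G) - μ G + μ G) := by
        simp only [tsub_add_cancel_of_le (h _), hm]
      _ = _ := by ring
  pointContinuous := lowerSemicontinuous_of_finite fun U r hr => by
    obtain ⟨F, hF, hFU, hV⟩ := μ.exists_finite (lt_tsub_iff_right.1 hr)
    refine ⟨F \ G, hF.subset sdiff_subset, fun x hx => (hFU hx.1).resolve_right hx.2,
      fun V hFV => lt_tsub_iff_right.2 (hV _ fun x hx => ?_)⟩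
    by_cases hxG : x ∈ G
    · exact Or.inr hxG
    · exact Or.inl (hFV ⟨hx, hxG⟩)

theorem restrict_add_corestrict (μ : PointValuation X) (G : Opens X) (hG : μ G ≠ ∞) :
    μ.restrict G + μ.corestrict G hG = μ := by
  ext W
  change μ (W ⊓ G) + (μ (W ⊔ G) - μ G) = μ W
  rw [← ENNReal.add_left_inj hG, add_assoc, tsub_add_cancel_of_le (μ.mono le_sup_right),
    μ.modular W G, add_comm]

/-- Uniform approximation from below of the values of a finite valuation at finitely many open
sets. -/
theorem exists_simple_le_add (l : List (Opens X)) (μ : PointValuation X) (hμ : μ ⊤ ≠ ∞)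
    (G : Opens X) {ε : ℝ≥0} (hε : 0 < ε) :
    ∃ a : X →₀ ℝ≥0, ↑a.support ⊆ (G : Set X) ∧ (∀ V, simple a V ≤ μ V) ∧
      μ G ≤ simple a ⊤ + ε ∧ ∀ U ∈ l, μ (U ⊓ G) ≤ simple a U + ε := by
  classical
  induction l generalizing μ G ε with
  | nil =>
    have hG : μ G ≠ ∞ := ne_top_of_le_ne_top hμ (μ.mono le_top)
    obtain h | h := le_or_gt (μ G) ε
    · exact ⟨0, by simp, fun V => by simp [zero_apply], by simpa [zero_apply] using h, by simp⟩
    · obtain ⟨a, ha, haμ, haG⟩ := μ.exists_simple_le_of_lt (U := G)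
        (r := (μ G - ε).toNNReal) (by
          rw [ENNReal.coe_toNNReal (ENNReal.sub_ne_top hG)]
          exact ENNReal.sub_lt_self hG (pos_of_gt h).ne' (by simpa using hε.ne'))
      refine ⟨a, ha, haμ, ?_, by simp⟩
      rw [haG, ENNReal.coe_toNNReal (ENNReal.sub_ne_top hG), tsub_add_cancel_of_le h.le]
  | cons U l ih =>
    have hU : μ U ≠ ∞ := ne_top_of_le_ne_top hμ (μ.mono le_top)
    have hsum : ∀ W, μ W = μ.restrict U W + μ.corestrict U hU W := fun W => by
      rw [← add_apply, restrict_add_corestrict]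
    -- Split `μ` into its parts on `U` and off `U`, and approximate each within `ε / 2`. Confining
    -- the first support to `U` makes its mass at `U` equal to its total mass; the arbitrary `G` in
    -- the statement serves this purpose.
    obtain ⟨a, haG, haμ, ha, hal⟩ := ih (μ.restrict U)
      (ne_top_of_le_ne_top hμ (by rw [hsum ⊤]; exact le_self_add)) (G ⊓ U) (half_pos hε)
    obtain ⟨b, hbG, hbμ, hb, hbl⟩ := ih (μ.corestrict U hU)
      (ne_top_of_le_ne_top hμ (by rw [hsum ⊤]; exact le_add_self)) G (half_pos hε)
    have hres : ∀ W, μ.restrict U (W ⊓ U) = μ.restrict U W := fun W => by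
      change μ (W ⊓ U ⊓ U) = μ (W ⊓ U)
      rw [inf_assoc, inf_idem]
    have hε2 : ∀ s t : ℝ≥0∞, (s + (ε / 2 : ℝ≥0)) + (t + (ε / 2 : ℝ≥0)) = s + t + ε := fun s t => by
      rw [add_add_add_comm, ← ENNReal.coe_add, add_halves]
    refine ⟨a + b, ?_, fun V => ?_, ?_, fun V hV => ?_⟩
    · refine (Finset.coe_subset.2 Finsupp.support_add).trans ?_
      rw [Finset.coe_union]
      exact union_subset (haG.trans inter_subset_left) hbG
    · rw [map_add, add_apply, hsum]
      exact add_le_add (haμ V) (hbμ V)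
    · rw [map_add, add_apply, hsum, ← hε2]
      rw [hres] at ha
      exact add_le_add ha hb
    · rw [map_add, add_apply]
      obtain rfl | hV := List.mem_cons.1 hV
      · rw [simple_apply_of_support_subset (haG.trans inter_subset_right)]
        have h1 : μ (V ⊓ G) = μ.restrict V (G ⊓ V) := by
          rw [hres, inf_comm]; rfl
        rw [h1]
        refine ha.trans ?_
        gcongr
        · exact le_self_add
        · exact half_le_self zero_le
      · rw [hsum, ← hε2, ← hres, inf_assoc]
        exact add_le_add (hal V hV) (hbl V hV)

/-- Finitely many lower bounds on a valuation hold for a finite valuation below it. -/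
theorem exists_finite_le (μ : PointValuation X) (T : Finset (Opens X × ℝ≥0))
    (hT : ∀ p ∈ T, (p.2 : ℝ≥0∞) < μ p.1) :
    ∃ ν : PointValuation X, ν ⊤ ≠ ∞ ∧ (∀ V, ν V ≤ μ V) ∧ ∀ p ∈ T, (p.2 : ℝ≥0∞) < ν p.1 := by
  classical
  suffices ∀ S : Finset (Opens X × ℝ≥0), ∃ ν : PointValuation X, ν ⊤ ≠ ∞ ∧ (∀ V, ν V ≤ μ V) ∧
      ∀ p ∈ T, μ p.1 ≠ ∞ ∨ p ∈ S → (p.2 : ℝ≥0∞) < ν p.1 by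
    obtain ⟨ν, h1, h2, h3⟩ := this T
    exact ⟨ν, h1, h2, fun p hp => h3 p hp (Or.inr hp)⟩
  intro S
  induction S using Finset.induction_on with
  | empty =>
    -- All bounds at open sets of finite mass are met at once by restricting to the union of these
    -- sets, which has finite mass. Those at sets of infinite mass are added one at a time.
    let G : Opens X := (T.filter fun p => μ p.1 ≠ ∞).sup Prod.fst
    have hG : μ G ≠ ∞ := by
      refine Finset.sup_induction (p := fun U => μ U ≠ ∞) (by simp [μ.strict]) ?_
        fun p hp => (Finset.mem_filter.1 hp).2
      intro U hU V hV
      refine ne_top_of_le_ne_top (ENNReal.add_ne_top.2 ⟨hU, hV⟩) ?_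
      rw [μ.modular]; exact le_self_add
    refine ⟨μ.restrict G, ?_, fun V => μ.mono inf_le_left, fun p hp h => ?_⟩
    · change μ (⊤ ⊓ G) ≠ ∞
      rwa [top_inf_eq]
    · change _ < μ (p.1 ⊓ G)
      rw [inf_eq_left.2]
      · exact hT p hp
      · exact Finset.le_sup (f := Prod.fst)
          (Finset.mem_filter.2 ⟨hp, h.resolve_right (Finset.notMem_empty p)⟩)
  | insert q S _ ih =>
    obtain ⟨ν, hν, hνμ, hνT⟩ := ih
    obtain hq | hq := ne_or_eq (μ q.1) ∞
    · refine ⟨ν, hν, hνμ, fun p hp h => hνT p hp ?_⟩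
      obtain h | h := h
      · exact Or.inl h
      · obtain rfl | h := Finset.mem_insert.1 h
        · exact Or.inl hq
        · exact Or.inr h
    -- Finitely many strict inequalities survive a slight shrinking of `ν`, which frees the weight
    -- `1 - c` for a new summand.
    obtain ⟨c, hc1, hc⟩ : ∃ c : ℝ≥0, c < 1 ∧ ∀ p ∈ T, μ p.1 ≠ ∞ ∨ p ∈ S →
        (p.2 : ℝ≥0∞) < c * ν p.1 := by
      have : ∀ᶠ c : ℝ≥0 in nhdsWithin 1 (Iio 1), ∀ p ∈ T, μ p.1 ≠ ∞ ∨ p ∈ S →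
          (p.2 : ℝ≥0∞) < c * ν p.1 := by
        rw [Filter.eventually_all_finset]
        intro p hp
        by_cases h : μ p.1 ≠ ∞ ∨ p ∈ S
        · simp only [h, true_imp_iff]
          have hp' := hνT p hp h
          have hcont : Continuous fun c : ℝ≥0 => (c : ℝ≥0∞) * ν p.1 :=
            (ENNReal.continuous_mul_const (ne_top_of_le_ne_top hν (ν.mono le_top))).comp
              ENNReal.continuous_coe
          refine Filter.Eventually.filter_mono nhdsWithin_le_nhds
            (hcont.continuousAt.eventually_const_lt ?_)
          simpa using hp'
        · simp [h]
      have hne : (nhdsWithin (1 : ℝ≥0) (Iio 1)).NeBot := nhdsLT_neBot_of_exists_lt ⟨0, one_pos⟩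
      obtain ⟨c, hc, h1⟩ := (this.and self_mem_nhdsWithin).exists
      exact ⟨c, h1, hc⟩
    have hc0 : 0 < 1 - c := tsub_pos_of_lt hc1
    -- The mass is chosen so that after scaling by `1 - c` it is `q.2 + 1`; infinite mass at `q.1`
    -- permits it.
    obtain ⟨a, haq, haμ, ha⟩ := μ.exists_simple_le_of_lt (U := q.1) (r := (q.2 + 1) / (1 - c))
      (by rw [hq]; exact ENNReal.coe_lt_top)
    refine ⟨c • ν + (1 - c) • simple a, ?_, fun V => ?_, fun p hp h => ?_⟩
    · exact ENNReal.add_ne_top.2 ⟨ENNReal.mul_ne_top ENNReal.coe_ne_top hν,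
        ENNReal.mul_ne_top ENNReal.coe_ne_top (simple_apply_ne_top a ⊤)⟩
    · calc (c : ℝ≥0∞) * ν V + ((1 - c : ℝ≥0) : ℝ≥0∞) * simple a V
          ≤ c * μ V + ((1 - c : ℝ≥0) : ℝ≥0∞) * μ V := by gcongr; exacts [hνμ V, haμ V]
        _ = μ V := by
          rw [← add_mul, ← ENNReal.coe_add, add_tsub_cancel_of_le hc1.le, ENNReal.coe_one, one_mul]
    · by_cases h' : μ p.1 ≠ ∞ ∨ p ∈ S
      · exact (hc p hp h').trans_le le_self_add
      · obtain rfl : p = q := by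
          obtain h | h := h
          · exact absurd (Or.inl h) h'
          · exact (Finset.mem_insert.1 h).resolve_right fun h => h' (Or.inr h)
        refine lt_of_lt_of_le ?_ (add_apply (c • ν) _ p.1 ▸ le_add_self)
        rw [smul_apply, simple_apply_of_support_subset haq, ha, ← ENNReal.coe_mul,
          mul_div_cancel₀ _ hc0.ne', ENNReal.coe_lt_coe]
        exact lt_add_one _

/-- Every neighbourhood of a valuation contains a simple valuation below it. -/
theorem exists_specializes_simple {W : Set (PointValuation X)} (hW : IsOpen W)
    {μ : PointValuation X} (hμ : μ ∈ W) : ∃ a : X →₀ ℝ≥0, μ ⤳ simple a ∧ simple a ∈ W := by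
  classical
  obtain ⟨T, hT, hTW⟩ := exists_finset_of_mem_isOpen hW hμ
  obtain ⟨ν, hν, hνμ, hνT⟩ := μ.exists_finite_le T hT
  obtain ⟨ε, hε, hεT⟩ : ∃ ε : ℝ≥0, 0 < ε ∧ ∀ p ∈ T, (p.2 : ℝ≥0∞) + ε < ν p.1 := by
    have : ∀ᶠ ε : ℝ≥0 in nhdsWithin 0 (Ioi 0), ∀ p ∈ T, (p.2 : ℝ≥0∞) + ε < ν p.1 := by
      rw [Filter.eventually_all_finset]
      intro p hp
      have hcont : Continuous fun ε : ℝ≥0 => (p.2 : ℝ≥0∞) + ε :=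
        continuous_const.add ENNReal.continuous_coe
      refine Filter.Eventually.filter_mono nhdsWithin_le_nhds
        (hcont.continuousAt.eventually_lt_const ?_)
      simpa using hνT p hp
    obtain ⟨ε, hε, h⟩ := (this.and self_mem_nhdsWithin).exists
    exact ⟨ε, h, hε⟩
  obtain ⟨a, -, haν, -, ha⟩ := exists_simple_le_add (T.toList.map Prod.fst) ν hν ⊤ hε
  refine ⟨a, specializes_iff.2 fun U => (haν U).trans (hνμ U), hTW _ fun p hp => ?_⟩
  have h := ha p.1 (List.mem_map.2 ⟨p, Finset.mem_toList.2 hp, rfl⟩)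
  rw [inf_top_eq] at h
  exact lt_of_add_lt_add_right ((hεT p hp).trans_le h)

/-- Density alone would not suffice: the simple valuation in `W` lies below `μ`, so its membership
in the upper set `W'` passes to `μ`. -/
theorem subset_of_simple_mem_imp {W W' : Set (PointValuation X)} (hW : IsOpen W) (hW' : IsOpen W')
    (h : ∀ a, simple a ∈ W → simple a ∈ W') : W ⊆ W' := fun μ hμ => by
  obtain ⟨a, ha, haW⟩ := exists_specializes_simple hW hμ
  exact ha.mem_open hW' (h a haW)

/-- Continuous maps into a `T₀` space that agree at simple valuations are equal. -/
theorem eq_of_eq_on_simple [T0Space Y] {f g : PointValuation X → Y} (hf : Continuous f)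
    (hg : Continuous g) (h : ∀ a, f (simple a) = g (simple a)) : f = g := by
  funext μ
  refine (inseparable_iff_forall_isOpen.2 fun O hO => ?_).eq
  exact ⟨fun hμ => subset_of_simple_mem_imp (hO.preimage hf) (hO.preimage hg)
      (fun a ha => by rwa [mem_preimage, ← h]) hμ,
    fun hμ => subset_of_simple_mem_imp (hO.preimage hg) (hO.preimage hf)
      (fun a ha => by rwa [mem_preimage, h]) hμ⟩

theorem eq_of_lowerSemicontinuous_of_eq_on_simple {f g : PointValuation X → ℝ≥0∞}
    (hf : LowerSemicontinuous f) (hg : LowerSemicontinuous g)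
    (h : ∀ a, f (simple a) = g (simple a)) : f = g := by
  funext μ
  refine eq_of_forall_lt_iff fun r => ?_
  exact ⟨fun hμ => subset_of_simple_mem_imp (hf.isOpen_preimage r) (hg.isOpen_preimage r)
      (fun a ha => by rwa [mem_preimage, ← h]) hμ,
    fun hμ => subset_of_simple_mem_imp (hg.isOpen_preimage r) (hf.isOpen_preimage r)
      (fun a ha => by rwa [mem_preimage, h]) hμ⟩

/-- Linear maps that agree at Dirac masses agree at simple valuations. -/
theorem map_simple {M : Type*} [AddCommMonoid M] [Module ℝ≥0 M] {f : PointValuation X → M}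
    (hf : IsLinearMap ℝ≥0 f) (a : X →₀ ℝ≥0) :
    f (simple a) = Finsupp.linearCombination ℝ≥0 (fun x => f (dirac x)) a := by
  change hf.mk' f (Finsupp.linearCombination ℝ≥0 dirac a) = _
  rw [Finsupp.linearCombination_apply, map_finsuppSum, Finsupp.linearCombination_apply]
  simp

theorem eq_of_eq_on_dirac {M : Type*} [TopologicalSpace M] [T0Space M] [AddCommMonoid M]
    [Module ℝ≥0 M] {f g : PointValuation X → M} (hf : Continuous f) (hg : Continuous g)
    (hfl : IsLinearMap ℝ≥0 f) (hgl : IsLinearMap ℝ≥0 g) (h : ∀ x, f (dirac x) = g (dirac x)) :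
    f = g :=
  eq_of_eq_on_simple hf hg fun a => by simp only [map_simple hfl, map_simple hgl, h]

/-! ### The integral as a function of the valuation -/

theorem lowerSemicontinuous_integral {h : X → ℝ≥0∞} (hh : LowerSemicontinuous h) :
    LowerSemicontinuous fun μ : PointValuation X => μ.integral h hh := by
  simp only [integral_eq_iSup]
  refine lowerSemicontinuous_iSup fun N => lowerSemicontinuous_sum fun j _ => ?_
  exact (ENNReal.continuous_const_mul ENNReal.coe_ne_top).comp_lowerSemicontinuous
    (lowerSemicontinuous_apply _) fun _ _ h => mul_le_mul_right h _

theorem isLinearMap_integral {h : X → ℝ≥0∞} (hh : LowerSemicontinuous h) :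
    IsLinearMap ℝ≥0 fun μ : PointValuation X => μ.integral h hh where
  map_add μ _ := lintegral_add_left (μ.mono.comp_antitone (antitone_superlevel h hh)).measurable _
  map_smul _ μ :=
    lintegral_const_mul _ (μ.mono.comp_antitone (antitone_superlevel h hh)).measurable

theorem integral_dirac {h : X → ℝ≥0∞} (hh : LowerSemicontinuous h) (x : X) :
    (dirac x).integral h hh = h x := by
  classical
  rw [integral_eq_iSup, iSup_step h hh x]
  refine iSup_congr fun N => Finset.sum_congr rfl fun j _ => ?_
  simp [dirac, indicator_apply]

theorem mult_dirac (μ : PointValuation X) : mult (dirac μ) = μ := by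
  ext U; exact integral_dirac _ μ

theorem continuous_mult : Continuous (mult : PointValuation (PointValuation X) → _) :=
  continuous_iff_forall_lowerSemicontinuous.2 fun _ => lowerSemicontinuous_integral _

theorem isLinearMap_mult :
    IsLinearMap ℝ≥0 (mult : PointValuation (PointValuation X) → PointValuation X) where
  map_add μ ν := by ext U; exact (isLinearMap_integral _).map_add μ ν
  map_smul r μ := by ext U; exact (isLinearMap_integral _).map_smul r μ

theorem map_dirac {f : X → Y} (hf : Continuous f) (x : X) : map f hf (dirac x) = dirac (f x) :=
  rfl

theorem continuous_map {f : X → Y} (hf : Continuous f) : Continuous (map f hf) :=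
  continuous_iff_forall_lowerSemicontinuous.2 fun _ => lowerSemicontinuous_apply _

theorem isLinearMap_map {f : X → Y} (hf : Continuous f) : IsLinearMap ℝ≥0 (map f hf) where
  map_add _ _ := rfl
  map_smul _ _ := rfl

end PointValuation

/-! ### Barycentres of simple valuations in topological cones -/

/-- A sum of elements of a convex set is a multiple of one of its elements. -/
theorem Convex.exists_smul_eq_sum {κ C : Type*} [AddCommMonoid C] [Module ℝ≥0 C] {A : Set C}
    (hA : Convex ℝ≥0 A) (hne : A.Nonempty) (F : Finset κ) (w : κ → ℝ≥0) (z : κ → C)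
    (hz : ∀ j ∈ F, w j ≠ 0 → z j ∈ A) :
    ∃ y ∈ A, ∑ j ∈ F, w j • z j = (∑ j ∈ F, w j) • y := by
  classical
  induction F using Finset.induction_on with
  | empty =>
    obtain ⟨y, hy⟩ := hne
    exact ⟨y, hy, by simp⟩
  | insert i F hi ih =>
    obtain ⟨y, hy, e⟩ := ih fun j hj => hz j (Finset.mem_insert_of_mem hj)
    rw [Finset.sum_insert hi, Finset.sum_insert hi, e]
    -- At weight zero, `z i` may lie outside `A` and the total weight may vanish.
    obtain h0 | h0 := eq_or_ne (w i) 0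
    · exact ⟨y, hy, by simp [h0]⟩
    have hs : w i + ∑ j ∈ F, w j ≠ 0 := fun h => h0 (add_eq_zero.1 h).1
    refine ⟨_, hA (hz i (Finset.mem_insert_self i F) h0) hy (a := w i / (w i + ∑ j ∈ F, w j))
      (b := (∑ j ∈ F, w j) / (w i + ∑ j ∈ F, w j)) zero_le zero_le ?_, ?_⟩
    · rw [← add_div, div_self hs]
    · rw [smul_add, smul_smul, smul_smul, mul_div_cancel₀ _ hs, mul_div_cancel₀ _ hs]

section Cone

variable {C : Type*} [TopologicalSpace C] [AddCommMonoid C] [Module ℝ≥0 C]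

theorem IsTopologicalCone.continuousAdd (hC : IsTopologicalCone C) : ContinuousAdd C :=
  ⟨hC.continuous_add⟩

theorem IsTopologicalCone.continuous_const_smul (hC : IsTopologicalCone C) (r : ℝ≥0) :
    Continuous fun x : C => r • x :=
  hC.continuous_smul.comp (Continuous.prodMk_right (Topology.WithScott.toScott r))

theorem IsTopologicalCone.continuous_smul_const (hC : IsTopologicalCone C) (x : C) :
    Continuous fun r : Topology.WithScott ℝ≥0 => Topology.WithScott.ofScott r • x :=
  hC.continuous_smul.comp (Continuous.prodMk_left x)

theorem Topology.WithScott.specializes_of_le {α : Type*} [Preorder α] {a b : Topology.WithScott α}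
    (h : a ≤ b) : b ⤳ a := by
  rw [specializes_iff_mem_closure, Topology.IsScott.closure_singleton]
  exact h

/-- A positive `r` is the directed supremum of the numbers below it, and Scott-open sets are
inaccessible by directed suprema. -/
theorem Topology.WithScott.exists_lt_mem {O : Set (Topology.WithScott ℝ≥0)} (hO : IsOpen O)
    {r : ℝ≥0} (hr : 0 < r) (h : Topology.WithScott.toScott r ∈ O) :
    ∃ s < r, Topology.WithScott.toScott s ∈ O := by
  have hO' := (Topology.IsScott.isOpen_iff_isUpperSet_and_dirSupInaccOn (D := univ).1 hO).2
  have hd : DirectedOn (· ≤ ·) (Iio r) := fun a ha b hb =>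
    ⟨max a b, mem_Iio.2 (max_lt ha hb), le_max_left a b, le_max_right a b⟩
  obtain ⟨s, hs, hsO⟩ := hO' (mem_univ _) (show (Iio r).Nonempty from ⟨0, hr⟩) hd
    (isLUB_Iio (a := r)) h
  exact ⟨s, hs, hsO⟩

theorem IsTopologicalCone.exists_lt_one_smul_mem (hC : IsTopologicalCone C) {O : Set C}
    (hO : IsOpen O) {x : C} (hx : x ∈ O) : ∃ c : ℝ≥0, c < 1 ∧ c • x ∈ O :=
  Topology.WithScott.exists_lt_mem (hO.preimage (hC.continuous_smul_const x)) one_pos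
    (show (1 : ℝ≥0) • x ∈ O by rwa [one_smul])

/-- Scott continuity of `r ↦ r • y` makes `y` specialize to `0`. This lets surplus mass be
discarded. -/
theorem IsTopologicalCone.add_specializes_left (hC : IsTopologicalCone C) (x y : C) :
    (x + y) ⤳ x := by
  have h := (Topology.WithScott.specializes_of_le
    (zero_le : (0 : ℝ≥0) ≤ 1)).map (hC.continuous_smul_const y)
  change ((1 : ℝ≥0) • y) ⤳ ((0 : ℝ≥0) • y) at h
  rw [one_smul, zero_smul] at h
  have := hC.continuousAdd
  have h2 := (specializes_refl x).prod h
  simpa using h2.map hC.continuous_add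

/-- The barycentre of a finitely supported weight function. -/
noncomputable abbrev linComb : (C →₀ ℝ≥0) →ₗ[ℝ≥0] C := Finsupp.linearCombination ℝ≥0 id

open PointValuation

/-- Weights `b` with enough mass near the convex sets `A i` dominate a combination of elements
of these sets. -/
theorem IsTopologicalCone.exists_linComb_specializes_sum (hC : IsTopologicalCone C)
    (I : Finset C) (p : C → ℝ≥0) {A : C → Set C} (hA : ∀ i, Convex ℝ≥0 (A i))
    (hne : ∀ i, (A i).Nonempty) (b : C →₀ ℝ≥0) (N : C → Finset C) (hNA : ∀ i, ↑(N i) ⊆ A i)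
    [DecidableEq C] (hN : ∀ i, N i ⊆ b.support)
    (h : ∀ S ⊆ I, ∑ i ∈ S, p i ≤ ∑ j ∈ S.biUnion N, b j) :
    ∃ y : C → C, (∀ i, y i ∈ A i) ∧ linComb b ⤳ ∑ i ∈ I, p i • y i := by
  obtain ⟨t, ht0, htp, htq⟩ := exists_transport N p I b h
  have hy : ∀ i, ∃ y ∈ A i, i ∈ I → ∑ j ∈ b.support, t i j • j = p i • y := fun i => by
    obtain ⟨y, hy, e⟩ := (hA i).exists_smul_eq_sum (hne i) (N i) (t i) id fun j hj _ => hNA i hj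
    refine ⟨y, hy, fun hi => ?_⟩
    rw [← htp i hi, ← e]
    refine (Finset.sum_subset (hN i) fun j _ hj => ?_).symm
    rw [ht0 i hi j hj, zero_smul]
  choose y hyA hy using hy
  refine ⟨y, hyA, ?_⟩
  -- Split the mass of `b` into the transported part and the surplus.
  have e : linComb b = ∑ j ∈ b.support, ∑ i ∈ I, t i j • j +
      ∑ j ∈ b.support, (b j - ∑ i ∈ I, t i j) • j := by
    rw [← Finset.sum_add_distrib, Finsupp.linearCombination_apply, Finsupp.sum]
    refine Finset.sum_congr rfl fun j _ => ?_
    rw [← Finset.sum_smul, ← add_smul, add_tsub_cancel_of_le (htq j), id]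
  rw [e, ← Finset.sum_congr rfl hy, Finset.sum_comm]
  exact hC.add_specializes_left _ _

/-- Perturbing the points of a finite sum within convex neighbourhoods, after slightly shrinking
the weights, keeps it inside an open set. -/
theorem IsTopologicalCone.exists_convex_nhds (hC : IsTopologicalCone C)
    (hw : IsWeaklyLocallyConvex C) {O : Set C} (hO : IsOpen O) {a : C →₀ ℝ≥0}
    (ha : linComb a ∈ O) :
    ∃ (c : ℝ≥0) (A : C → Set C), c < 1 ∧ (∀ i, A i ∈ nhds i) ∧ (∀ i, Convex ℝ≥0 (A i)) ∧
      ∀ y : C → C, (∀ i, y i ∈ A i) → ∑ i ∈ a.support, (c * a i) • y i ∈ O := by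
  have := hC.continuousAdd
  -- The factor `c < 1` creates the slack needed for strict inequalities that define an open set of
  -- valuations.
  obtain ⟨c, hc1, hcO⟩ := hC.exists_lt_one_smul_mem hO ha
  let φ : (C → C) → C := fun y => ∑ i ∈ a.support, (c * a i) • y i
  have hφ : Continuous φ := continuous_finsetSum _ fun i _ =>
    (hC.continuous_const_smul _).comp (continuous_apply i)
  have hφO : φ id ∈ O := by
    rw [Finsupp.linearCombination_apply, Finsupp.sum, Finset.smul_sum] at hcO
    simpa [φ, mul_smul] using hcO
  obtain ⟨J, V, hV, hVO⟩ := isOpen_pi_iff.1 (hO.preimage hφ) id hφO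
  have hex : ∀ i : C, ∃ A ∈ nhds i, Convex ℝ≥0 A ∧ (i ∈ J → A ⊆ V i) := fun i => by
    by_cases hi : i ∈ J
    · obtain ⟨A, hA, hAV, hAc⟩ := hw i (V i) (hV i hi).1 (hV i hi).2
      exact ⟨A, hA, hAc, fun _ => hAV⟩
    · exact ⟨univ, Filter.univ_mem, convex_univ, fun h => absurd h hi⟩
  choose A hA hAc hAV using hex
  have hyO : ∀ y : C → C, (∀ i, y i ∈ A i) → φ y ∈ O := fun y hy =>
    hVO (mem_pi.2 fun i hi => hAV i hi (hy i))
  exact ⟨c, A, hc1, hA, hAc, hyO⟩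

/-- Continuity of the barycentre of a simple valuation. -/
theorem IsTopologicalCone.exists_isOpen_simple (hC : IsTopologicalCone C)
    (hw : IsWeaklyLocallyConvex C) {O : Set C} (hO : IsOpen O) {a : C →₀ ℝ≥0}
    (ha : linComb a ∈ O) :
    ∃ W : Set (PointValuation C), IsOpen W ∧ simple a ∈ W ∧
      ∀ b : C →₀ ℝ≥0, simple b ∈ W → linComb b ∈ O := by
  classical
  obtain ⟨c, A, hc1, hA, hAc, hsumO⟩ := hC.exists_convex_nhds hw hO ha
  obtain ⟨U, hUA, hiU⟩ : ∃ U : C → Opens C, (∀ i, (U i : Set C) ⊆ A i) ∧ ∀ i, i ∈ U i :=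
    ⟨fun i => ⟨interior (A i), isOpen_interior⟩, fun i => interior_subset,
      fun i => mem_interior_iff_mem_nhds.2 (hA i)⟩
  -- Hall's condition for the demands `c * a i`, as an open condition. The empty `S` is left out
  -- below, since its strict inequality `0 < μ ⊥` fails.
  let B (S : Finset C) : Set (PointValuation C) :=
    {μ | ((c * ∑ i ∈ S, a i : ℝ≥0) : ℝ≥0∞) < μ (S.sup U)}
  have hB : ∀ S, IsOpen (B S) := fun S => isOpen_setOf_lt (S.sup U) (c * ∑ i ∈ S, a i)
  have hW : IsOpen (⋂ S ∈ a.support.powerset.erase ∅, B S) :=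
    isOpen_biInter_finset fun S _ => hB S
  refine ⟨_, hW, ?_, fun b hb => ?_⟩
  · simp only [mem_iInter, Finset.mem_erase, Finset.mem_powerset]
    rintro S ⟨hS, hSI⟩
    have hpos : 0 < ∑ i ∈ S, a i := Finset.sum_pos
      (fun i hi => pos_iff_ne_zero.2 (Finsupp.mem_support_iff.1 (hSI hi)))
      (Finset.nonempty_iff_ne_empty.2 hS)
    refine lt_of_lt_of_le (ENNReal.coe_lt_coe.2 (mul_lt_of_lt_one_left hpos hc1)) ?_
    rw [simple_apply subset_rfl, ENNReal.ofNNReal_finsetSum]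
    refine Finset.sum_le_sum_of_subset fun i hi => Finset.mem_filter.2 ⟨hSI hi, ?_⟩
    exact Finset.le_sup (f := U) hi (hiU i)
  · simp only [mem_iInter, Finset.mem_erase, Finset.mem_powerset] at hb
    obtain ⟨y, hyA, hy⟩ := hC.exists_linComb_specializes_sum a.support (fun i => c * a i) hAc
      (fun i => ⟨i, mem_of_mem_nhds (hA i)⟩) b (fun i => b.support.filter (· ∈ U i))
      (fun i j hj => hUA i (Finset.mem_filter.1 hj).2)
      (fun i => Finset.filter_subset _ _) fun S hS => by
        obtain rfl | hne := eq_or_ne S ∅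
        · simp
        have h : ((c * ∑ i ∈ S, a i : ℝ≥0) : ℝ≥0∞) < simple b (S.sup U) := hb S ⟨hne, hS⟩
        replace h := h.le
        rw [simple_apply subset_rfl, ← ENNReal.ofNNReal_finsetSum, ENNReal.coe_le_coe,
          Finset.mul_sum] at h
        refine h.trans (le_of_eq (Finset.sum_congr ?_ fun _ _ => rfl))
        ext j
        simp only [Finset.mem_filter, Finset.mem_biUnion, Finset.sup_eq_iSup, Opens.mem_iSup]
        grind
    exact hy.mem_open hO (hsumO y hyA)

/-- Existence of barycentre maps. -/
theorem IsTopologicalCone.exists_continuous_linear (hC : IsTopologicalCone C)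
    (hw : IsWeaklyLocallyConvex C) (hs : IsSober C) :
    ∃ α : PointValuation C → C, Continuous α ∧ IsLinearMap ℝ≥0 α ∧
      ∀ x : C, α (dirac x) = x := by
  have := hC.t0
  have := hs.2
  have := hC.continuousAdd
  -- Approximating `μ` from below inside the intersection of two open sets makes this set
  -- irreducible.
  let S (μ : PointValuation C) : Set C := linComb '' {a : C →₀ ℝ≥0 | μ ⤳ simple a}
  have hS : ∀ μ, IsIrreducible (S μ) := fun μ => by
    refine ⟨⟨_, 0, ?_, rfl⟩, ?_⟩
    · exact specializes_iff.2 fun U => by simp [PointValuation.zero_apply]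
    · rintro O₁ O₂ hO₁ hO₂ ⟨_, ⟨a₁, ha₁, rfl⟩, h₁⟩ ⟨_, ⟨a₂, ha₂, rfl⟩, h₂⟩
      obtain ⟨W₁, hW₁, haW₁, hWO₁⟩ := hC.exists_isOpen_simple hw hO₁ h₁
      obtain ⟨W₂, hW₂, haW₂, hWO₂⟩ := hC.exists_isOpen_simple hw hO₂ h₂
      obtain ⟨b, hb, hbW⟩ := exists_specializes_simple (hW₁.inter hW₂)
        (μ := μ) ⟨ha₁.mem_open hW₁ haW₁, ha₂.mem_open hW₂ haW₂⟩
      exact ⟨_, ⟨b, hb, rfl⟩, hWO₁ b hbW.1, hWO₂ b hbW.2⟩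
  let α (μ : PointValuation C) : C := (hS μ).genericPoint
  have hα : ∀ μ, ∀ O : Set C, IsOpen O →
      (α μ ∈ O ↔ ∃ a, μ ⤳ simple a ∧ linComb a ∈ O) := fun μ O hO => by
    rw [(hS μ).isGenericPoint_genericPoint_closure.mem_open_set_iff hO,
      closure_inter_open_nonempty_iff hO]
    constructor
    · rintro ⟨_, ⟨a, ha, rfl⟩, h⟩
      exact ⟨a, ha, h⟩
    · rintro ⟨a, ha, h⟩
      exact ⟨_, ⟨a, ha, rfl⟩, h⟩
  have hcont : Continuous α := by
    refine continuous_def.2 fun O hO => isOpen_iff_forall_mem_open.2 fun μ hμ => ?_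
    obtain ⟨a, ha, haO⟩ := (hα μ O hO).1 hμ
    obtain ⟨W, hW, haW, hWO⟩ := hC.exists_isOpen_simple hw hO haO
    refine ⟨W, fun ν hν => ?_, hW, ha.mem_open hW haW⟩
    obtain ⟨b, hb, hbW⟩ := exists_specializes_simple hW hν
    exact (hα ν O hO).2 ⟨b, hb, hWO b hbW⟩
  have hsimple : ∀ a, α (simple a) = linComb a := fun a => by
    refine (inseparable_iff_forall_isOpen.2 fun O hO => ?_).eq
    rw [hα _ O hO]
    refine ⟨?_, fun h => ⟨a, specializes_rfl, h⟩⟩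
    rintro ⟨b, hb, hbO⟩
    -- Continuity makes `linComb` monotone: combinations from simple valuations below `simple a` lie
    -- below `linComb a`.
    obtain ⟨W, hW, hbW, hWO⟩ := hC.exists_isOpen_simple hw hO hbO
    exact hWO a (hb.mem_open hW hbW)
  refine ⟨α, hcont, ⟨?_, fun r => ?_⟩, fun x => ?_⟩
  · have h1 : ∀ b μ, α (μ + simple b) = α μ + α (simple b) := fun b => congrFun <|
      eq_of_eq_on_simple (hcont.comp (continuous_id.add continuous_const))
        (hcont.add continuous_const) fun a => by
          simp only [← map_add, hsimple]
    exact fun μ => congrFun <|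
      eq_of_eq_on_simple (f := fun ν => α (μ + ν))
        (hcont.comp (continuous_const.add continuous_id))
        (continuous_const.add hcont) fun b => h1 b μ
  · exact congrFun <| eq_of_eq_on_simple (f := fun μ => α (r • μ))
      (hcont.comp (PointValuation.continuous_const_smul r))
      ((hC.continuous_const_smul r).comp hcont) fun a => by
        simp only [← map_smul, hsimple]
  · rw [dirac_eq_simple, hsimple, Finsupp.linearCombination_single, one_smul, id]

/-- Both sides of the multiplication law are continuous and linear in `ϖ`, so comparing them at
Dirac masses suffices. -/
theorem isPointValuationAlgebra_of_isLinearMap [T0Space C] {α : PointValuation C → C}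
    (hα : Continuous α) (hl : IsLinearMap ℝ≥0 α) (h : ∀ x : C, α (dirac x) = x) :
    IsPointValuationAlgebra α := by
  refine ⟨hα, h, congrFun <| eq_of_eq_on_dirac (f := fun ϖ => α (mult ϖ)) (hα.comp continuous_mult)
    (hα.comp (continuous_map hα))
    ((hl.mk' α).comp (isLinearMap_mult.mk' mult)).isLinear
    ((hl.mk' α).comp ((isLinearMap_map hα).mk' _)).isLinear fun μ => ?_⟩
  simp [mult_dirac, map_dirac, h]

/-- A continuous linear retraction of the Dirac embedding sends valuations to barycentres. -/
theorem isBarycentre_of_isLinearMap {α : PointValuation C → C}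
    (hα : Continuous α) (hl : IsLinearMap ℝ≥0 α) (h : ∀ x : C, α (dirac x) = x)
    (μ : PointValuation C) : IsBarycentre μ (α μ) := fun Λ hΛ => by
  refine congrFun (eq_of_lowerSemicontinuous_of_eq_on_simple (f := fun μ => Λ (α μ))
    (hΛ.comp hα) (lowerSemicontinuous_integral hΛ) fun a => ?_) μ
  rw [map_simple (isLinearMap_integral hΛ)]
  refine (map_simple (Λ.comp (hl.mk' α)).isLinear a).trans ?_
  simp [PointValuation.integral_dirac, h]

end Cone

/-! ### The cone structure of an algebra -/

namespace PointValuation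

variable {X : Type*} [TopologicalSpace X]

theorem convex_setOf_lt (U : Opens X) (r : ℝ≥0∞) :
    Convex ℝ≥0 {ν : PointValuation X | r < ν U} := fun μ hμ ν hν a b _ _ hab => by
  change r < μ U at hμ
  change r < ν U at hν
  refine (lt_min hμ hν).trans_le ?_
  calc min (μ U) (ν U) = a * min (μ U) (ν U) + b * min (μ U) (ν U) := by
        rw [← add_mul, ← ENNReal.coe_add, hab, ENNReal.coe_one, one_mul]
    _ ≤ a * μ U + b * ν U := by gcongr; exacts [min_le_left _ _, min_le_right _ _]

theorem isWeaklyLocallyConvex : IsWeaklyLocallyConvex (PointValuation X) := fun μ W hW hμ => by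
  obtain ⟨T, hT, hTW⟩ := exists_finset_of_mem_isOpen hW hμ
  refine ⟨⋂ p ∈ T, {ν | (p.2 : ℝ≥0∞) < ν p.1}, ?_, fun ν hν => hTW ν (by simpa using hν), ?_⟩
  · exact (isOpen_biInter_finset fun p _ => isOpen_setOf_lt _ _).mem_nhds (by simpa using hT)
  · exact convex_iInter fun p => convex_iInter fun _ => convex_setOf_lt p.1 p.2

end PointValuation

section Algebra

open PointValuation

variable {X : Type*} [TopologicalSpace X] {α : PointValuation X → X}

/-- The multiplication law at `dirac μ + dirac ν`. -/
theorem IsPointValuationAlgebra.map_add (h : IsPointValuationAlgebra α) (μ ν : PointValuation X) :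
    α (μ + ν) = α (dirac (α μ) + dirac (α ν)) := by
  obtain ⟨hα, -, hm⟩ := h
  have e := hm (dirac μ + dirac ν)
  rwa [isLinearMap_mult.map_add, mult_dirac, mult_dirac, (isLinearMap_map hα).map_add, map_dirac,
    map_dirac] at e

theorem IsPointValuationAlgebra.map_smul (h : IsPointValuationAlgebra α) (r : ℝ≥0)
    (μ : PointValuation X) : α (r • μ) = α (r • dirac (α μ)) := by
  obtain ⟨hα, -, hm⟩ := h
  have e := hm (r • dirac μ)
  rwa [isLinearMap_mult.map_smul, mult_dirac, (isLinearMap_map hα).map_smul, map_dirac] at e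

/-- The addition of an algebra. -/
noncomputable abbrev IsPointValuationAlgebra.addCommMonoid (h : IsPointValuationAlgebra α) :
    AddCommMonoid X where
  add x y := α (dirac x + dirac y)
  zero := α 0
  nsmul := @nsmulRec X ⟨α 0⟩ ⟨fun x y => α (dirac x + dirac y)⟩
  nsmul_zero _ := rfl
  nsmul_succ _ _ := rfl
  add_assoc x y z := by
    change α (dirac (α (dirac x + dirac y)) + dirac z) = α (dirac x + dirac (α (dirac y + dirac z)))
    have h1 := h.map_add (dirac x + dirac y) (dirac z)
    have h2 := h.map_add (dirac x) (dirac y + dirac z)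
    rw [h.2.1] at h1 h2
    rw [← h1, ← h2, add_assoc]
  zero_add x := by
    change α (dirac (α 0) + dirac x) = x
    have h1 := h.map_add 0 (dirac x)
    rw [h.2.1, zero_add, h.2.1] at h1
    exact h1.symm
  add_zero x := by
    change α (dirac x + dirac (α 0)) = x
    have h1 := h.map_add (dirac x) 0
    rw [h.2.1, add_zero, h.2.1] at h1
    exact h1.symm
  add_comm x y := congrArg α (add_comm _ _)

/-- The cone structure of an algebra. -/
noncomputable abbrev IsPointValuationAlgebra.module (h : IsPointValuationAlgebra α) :
    @Module ℝ≥0 X _ h.addCommMonoid :=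
  letI := h.addCommMonoid
  letI : SMul ℝ≥0 X := ⟨fun r x => α (r • dirac x)⟩
  -- The axioms descend along `α`, which is onto and respects both operations.
  Function.Surjective.module ℝ≥0
    (⟨⟨α, rfl⟩, h.map_add⟩ : PointValuation X →+ X) (fun x => ⟨dirac x, h.2.1 x⟩) h.map_smul

/-- The retraction carries the generic point of the closure of `i '' S` to one of `S`. -/
theorem IsSober.of_retract {Y : Type*} [TopologicalSpace Y] [T0Space X] (hY : IsSober Y)
    {i : X → Y} {p : Y → X} (hi : Continuous i) (hp : Continuous p) (h : ∀ x, p (i x) = x) :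
    IsSober X := by
  refine ⟨inferInstance, ⟨fun {S} hS hSc => ?_⟩⟩
  have := hY.2
  have hS' := hS.image i hi.continuousOn
  have hg := hS'.isGenericPoint_genericPoint_closure
  refine ⟨p hS'.genericPoint, ?_⟩
  have h1 := hg.image hp
  rwa [closure_image_closure hp, image_image, image_congr fun x _ => h x, image_id',
    hSc.closure_eq] at h1

theorem IsPointValuationAlgebra.exists_cone [T0Space X] (h : IsPointValuationAlgebra α) :
    ∃ (_ : AddCommMonoid X) (_ : Module ℝ≥0 X),
      (∀ x y : X, x + y = α (dirac x + dirac y)) ∧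
      (∀ (r : ℝ≥0) (x : X), r • x = α (r • dirac x)) ∧
      IsTopologicalCone X ∧ IsWeaklyLocallyConvex X ∧ IsSober X ∧
      Continuous α ∧ IsLinearMap ℝ≥0 α ∧
      (∀ μ : PointValuation X, IsBarycentre μ (α μ)) ∧ (∀ x : X, α (dirac x) = x) := by
  let := h.addCommMonoid
  let := h.module
  obtain ⟨hα, hd, -⟩ := id h
  have hl : IsLinearMap ℝ≥0 α := ⟨h.map_add, h.map_smul⟩
  refine ⟨h.addCommMonoid, h.module, fun _ _ => rfl, fun _ _ => rfl, ⟨inferInstance, ?_, ?_⟩, ?_,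
    PointValuation.isSober.of_retract continuous_dirac hα hd, hα, hl,
    isBarycentre_of_isLinearMap hα hl hd, hd⟩
  · exact hα.comp
      ((continuous_dirac.comp continuous_fst).add (continuous_dirac.comp continuous_snd))
  · exact hα.comp (continuous_scott_smul.comp
      (continuous_fst.prodMk (continuous_dirac.comp continuous_snd)))
  · intro x U hU hx
    obtain ⟨A, hA, hAU, hAc⟩ := PointValuation.isWeaklyLocallyConvex (dirac x) (α ⁻¹' U)
      (hU.preimage hα) (by rwa [mem_preimage, hd])
    -- `α '' A` is a neighbourhood of `x` because it contains the preimage of `A` under `dirac`.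
    refine ⟨α '' A, ?_, image_subset_iff.2 hAU, hAc.is_linear_image hl⟩
    filter_upwards [continuous_dirac.continuousAt hA] with y hy
    exact ⟨_, hy, hd y⟩

end Algebra

/-! ### Algebras and weakly locally convex sober cones -/

theorem mainTheorem8 :
    (∀ (X : Type*) [TopologicalSpace X] [T0Space X] (α : PointValuation X → X),
      IsPointValuationAlgebra α →
        ∃ (_ : AddCommMonoid X) (_ : Module ℝ≥0 X),
          (∀ x y : X, x + y = α (PointValuation.dirac x + PointValuation.dirac y)) ∧
          (∀ (r : ℝ≥0) (x : X), r • x = α (r • PointValuation.dirac x)) ∧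
          IsTopologicalCone X ∧ IsWeaklyLocallyConvex X ∧ IsSober X ∧
          Continuous α ∧ IsLinearMap ℝ≥0 α ∧
          (∀ μ : PointValuation X, IsBarycentre μ (α μ)) ∧
          (∀ x : X, α (PointValuation.dirac x) = x)) ∧
    (∀ (C : Type*) [TopologicalSpace C] [AddCommMonoid C] [Module ℝ≥0 C],
      IsTopologicalCone C → IsWeaklyLocallyConvex C → IsSober C →
        (∃! α : PointValuation C → C, Continuous α ∧ IsLinearMap ℝ≥0 α ∧
          ∀ x : C, α (PointValuation.dirac x) = x) ∧
        (∀ α : PointValuation C → C, Continuous α → IsLinearMap ℝ≥0 α →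
          (∀ x : C, α (PointValuation.dirac x) = x) → IsPointValuationAlgebra α)) := by
  refine ⟨fun X _ _ α h => h.exists_cone, fun C _ _ _ hC hw hs => ?_⟩
  have := hC.t0
  refine ⟨?_, fun α => isPointValuationAlgebra_of_isLinearMap⟩
  obtain ⟨α, hα, hl, hd⟩ := hC.exists_continuous_linear hw hs
  refine ⟨α, ⟨hα, hl, hd⟩, fun β ⟨hβ, hβl, hβd⟩ => ?_⟩
  exact PointValuation.eq_of_eq_on_dirac hβ hα hβl hl fun x => by rw [hβd, hd]
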